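/- Let $P\subset\mathbb{R}^n$ be an oriented simple $n$-dimensional convex polytope with $m$ facets $F_1,\dots,F_m$, presented irredundantly as $P=\{x:\langle a_j,x\rangle+b_j\ge 0,\ 1\le j\le m\}$ with inward pointing unit normals $a_j$, and finely ordered, i.e. $F_1\cap\dots\cap F_n$ is a vertex. Let $\varLambda=(\lambda_{i,j})$ be a refined integral $n\times m$ matrix: its first $n$ columns form the identity matrix, and $\det(\lambda_{j_1}\cdots\lambda_{j_n})=\pm1$ for the columns $\lambda_{j_1},\dots,\lambda_{j_n}$ whenever $F_{j_1}\cap\dots\cap F_{j_n}$ is a vertex of $P$. Let $$\mathcal Z_P=\{(x,z)\in P\times\mathbb{C}^m:\ |z_j|^2=\langle a_j,x\rangle+b_j\ \text{for all } j\}$$ be the moment-angle manifold, let $K$ be the kernel of the epimorphism of tori $T^m\to T^n$ defined by $\varLambda$, which acts freely on $\mathcal Z_P$ through the coordinatewise action of $T^m$ on $\mathbb{C}^m$, and let $M=M(P,\varLambda)=\mathcal Z_P/K$ be the associated quasitoric manifold. Let $\rho_1\oplus\dots\oplus\rho_m=\mathcal Z_P\times_K\mathbb{C}^m$ be the complex vector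 bundle over $M$ obtained from $\mathcal Z_P\times\mathbb{C}^m$ by factoring out the diagonal action of $K$, and let $c_\tau$ be the canonical stably complex structure $$\tau(M)\oplus\mathbb{R}^{2(m-n)}\;\cong\;\rho_1\oplus\dots\oplus\rho_m$$ on $M$, obtained by factoring out the isomorphism $\tau(\mathcal Z_P)\oplus\nu(\mathcal Z_P\subset\mathbb{C}^m)\cong\mathcal Z_P\times\mathbb{C}^m$ by $K$; its first Chern class $c_1(c_\tau)\in H^2(M;\mathbb{Z})$ is that of the complex bundle $\rho_1\oplus\dots\oplus\rho_m$. The omniorientation of $M$ induced by $(P,\varLambda)$ is called special when $c_1(c_\tau)=0$. Then the omniorientation is special if and only if every column of $\varLambda$ sums to $1$, that is, $$\sum_{i=1}^n\lambda_{i,j}=1\qquad\text{for every } 1\le j\le m .$$ -/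

import Mathlib

open scoped RealInnerProductSpace

noncomputable section

/-! ### Čech cohomology -/

section Cech

/-- An open cover of `B` indexed by the points of `B`, the `x`-th member being a neighbourhood of
`x`. Every open cover is refined by one of these, so Čech cohomology may be computed with them. -/
def IsPointedCover {B : Type*} [TopologicalSpace B] (U : B → Set B) : Prop :=
  ∀ x, IsOpen (U x) ∧ x ∈ U x

theorem IsPointedCover.inter {B : Type*} [TopologicalSpace B] {U V : B → Set B}
    (hU : IsPointedCover U) (hV : IsPointedCover V) : IsPointedCover fun x => U x ∩ V x :=
  fun x => ⟨(hU x).1.inter (hV x).1, (hU x).2, (hV x).2⟩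

variable (B : Type*) [TopologicalSpace B] (A : Type*) [AddCommGroup A]

/-- The Čech differential `(dc)(x₀,…,x_{p+1}) = ∑ᵢ (-1)ⁱ c(x₀,…,x̂ᵢ,…,x_{p+1})`. -/
def cechD (p : ℕ) :
    ((Fin (p + 1) → B) → B → A) →+ ((Fin (p + 2) → B) → B → A) where
  toFun c := fun x b => ∑ i : Fin (p + 2), (-1 : ℤ) ^ (i : ℕ) • c (fun j => x (i.succAbove j)) b
  map_zero' := by
    funext x b
    simp
  map_add' c c' := by
    funext x b
    simp [Finset.sum_add_distrib]

/-- Families that vanish on all `(p+1)`-fold intersections of some cover: these represent zero in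
the direct limit over all covers. -/
def cechNull (p : ℕ) : AddSubgroup ((Fin (p + 1) → B) → B → A) where
  carrier := {c | ∃ U : B → Set B, IsPointedCover U ∧ ∀ x b, (∀ i, b ∈ U (x i)) → c x b = 0}
  zero_mem' := ⟨fun _ => Set.univ, fun _ => ⟨isOpen_univ, trivial⟩, fun _ _ _ => rfl⟩
  add_mem' := by
    rintro c c' ⟨U, hU, h⟩ ⟨V, hV, h'⟩
    refine ⟨_, hU.inter hV, fun x b hb => ?_⟩
    simp [h x b fun i => (hb i).1, h' x b fun i => (hb i).2]
  neg_mem' := by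
    rintro c ⟨U, hU, h⟩
    exact ⟨U, hU, fun x b hb => by simp [h x b hb]⟩

variable [TopologicalSpace A] [IsTopologicalAddGroup A]

/-- Čech `p`-cochains, with values in the sheaf of continuous `A`-valued functions: families
`c(x₀,…,x_p)` which, for some cover `U`, are continuous on `U_{x₀} ∩ … ∩ U_{x_p}`. For discrete
`A`, such as `ℤ`, these are the locally constant functions. -/
def cechCochains (p : ℕ) : AddSubgroup ((Fin (p + 1) → B) → B → A) where
  carrier := {c | ∃ U : B → Set B, IsPointedCover U ∧ ∀ x, ContinuousOn (c x) {b | ∀ i, b ∈ U (x i)}}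
  zero_mem' := ⟨fun _ => Set.univ, fun _ => ⟨isOpen_univ, trivial⟩, fun _ => continuousOn_const⟩
  add_mem' := by
    rintro c c' ⟨U, hU, h⟩ ⟨V, hV, h'⟩
    exact ⟨_, hU.inter hV, fun x => ((h x).mono fun b hb i => (hb i).1).add
      ((h' x).mono fun b hb i => (hb i).2)⟩
  neg_mem' := by
    rintro c ⟨U, hU, h⟩
    exact ⟨U, hU, fun x => (h x).neg⟩

/-- Čech cocycles: cochains whose differential vanishes on some cover. -/
def cechCocycles (p : ℕ) : AddSubgroup ((Fin (p + 1) → B) → B → A) :=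
  cechCochains B A p ⊓ (cechNull B A (p + 1)).comap (cechD B A p)

/-- Čech coboundaries (up to families vanishing on some cover). -/
def cechCoboundaries : (p : ℕ) → AddSubgroup ((Fin (p + 1) → B) → B → A)
  | 0 => cechNull B A 0
  | p + 1 => (cechCochains B A p).map (cechD B A p) ⊔ cechNull B A (p + 1)

/-- The Čech cohomology group `Ȟᵖ(B; A)`, the direct limit over all open covers of `B`. -/
abbrev CechH (p : ℕ) : Type _ :=
  cechCocycles B A p ⧸ (cechCoboundaries B A p).addSubgroupOf (cechCocycles B A p)

end Cech

/-! ### The first Chern class of a complex vector bundle -/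

section Chern

open Bundle

variable {B : Type*} [TopologicalSpace B] (F : Type*) [NormedAddCommGroup F] [NormedSpace ℂ F]
  (E : B → Type*) [TopologicalSpace (TotalSpace F E)]
  [∀ b, AddCommGroup (E b)] [∀ b, Module ℂ (E b)]
  [∀ b, TopologicalSpace (E b)] [FiberBundle F E] [VectorBundle ℂ F E]

/-- The transition functions `g_{xy} = det (e_x ∘ e_y⁻¹)` of the determinant line bundle of `E`,
where `e_x` is the preferred local trivialization of `E` around `x`. -/
def detTransition (x y b : B) : ℂ :=
  LinearMap.det (((trivializationAt F E y).coordChangeL ℂ (trivializationAt F E x) b :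
    F →L[ℂ] F) : F →ₗ[ℂ] F)

/-- `c` is the image of the class of `(g_{xy})` under the connecting homomorphism
`Ȟ¹(B; ℂ*) → Ȟ²(B; ℤ)` of the exponential sequence `0 → ℤ → ℂ → ℂ* → 0`: on a sufficiently fine
cover write `g_{xy} = exp (2πi ℓ_{xy})`; then `c` is the class of the integral cocycle
`dℓ = ℓ_{yw} - ℓ_{xw} + ℓ_{xy}`. -/
def IsFirstChernClass (c : CechH B ℤ 2) : Prop :=
  ∃ U : B → Set B, IsPointedCover U ∧ (∀ x, U x ⊆ (trivializationAt F E x).baseSet) ∧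
    ∃ ℓ : (Fin 2 → B) → B → ℂ,
      (∀ x, ContinuousOn (ℓ x) {b | ∀ i, b ∈ U (x i)}) ∧
      (∀ x b, (∀ i, b ∈ U (x i)) →
        Complex.exp (2 * Real.pi * Complex.I * ℓ x b) = detTransition F E (x 0) (x 1) b) ∧
      ∃ z : cechCocycles B ℤ 2, (z : CechH B ℤ 2) = c ∧
        ∀ x b, (∀ i, b ∈ U (x i)) → ((z.1 x b : ℤ) : ℂ) = cechD B ℂ 1 ℓ x b

variable {F E}

theorem detTransition_cocycle {x y w b : B} (hx : b ∈ (trivializationAt F E x).baseSet)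
    (hy : b ∈ (trivializationAt F E y).baseSet) (hw : b ∈ (trivializationAt F E w).baseSet) :
    detTransition F E x y b * detTransition F E y w b = detTransition F E x w b := by
  rw [detTransition, detTransition, detTransition, ← LinearMap.det_comp]
  congr 1
  ext v
  simp only [LinearMap.comp_apply, ContinuousLinearMap.coe_coe, ContinuousLinearEquiv.coe_coe]
  rw [Trivialization.coordChangeL_apply _ _ ⟨hw, hy⟩, Trivialization.coordChangeL_apply _ _ ⟨hy, hx⟩,
    Trivialization.coordChangeL_apply _ _ ⟨hw, hx⟩]
  congr 2
  have := Trivialization.symm_apply_apply_mk (trivializationAt F E y) hy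
    ((trivializationAt F E w).symm b v)
  rw [this]

theorem detTransition_self {x b : B} (hx : b ∈ (trivializationAt F E x).baseSet) :
    detTransition F E x x b = 1 := by
  rw [detTransition]
  convert LinearMap.det_id
  ext v
  simp only [ContinuousLinearMap.coe_coe, ContinuousLinearEquiv.coe_coe]
  rw [Trivialization.coordChangeL_apply _ _ ⟨hx, hx⟩, Trivialization.apply_mk_symm _ hx]
  rfl

theorem continuousOn_detTransition [FiniteDimensional ℂ F] (x y : B) :
    ContinuousOn (detTransition F E x y)
      ((trivializationAt F E y).baseSet ∩ (trivializationAt F E x).baseSet) :=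
  ContinuousLinearMap.continuous_det.comp_continuousOn
    (continuousOn_coordChange ℂ (trivializationAt F E y) (trivializationAt F E x))

theorem exp_eq_one_iff_int {ℓ : ℂ} (h : Complex.exp (2 * Real.pi * Complex.I * ℓ) = 1) :
    ((round ℓ.re : ℤ) : ℂ) = ℓ := by
  obtain ⟨n, hn⟩ := Complex.exp_eq_one_iff.1 h
  have h2 : ℓ = n := by
    have h0 : (2 * Real.pi * Complex.I : ℂ) ≠ 0 := Complex.two_pi_I_ne_zero
    apply mul_left_cancel₀ h0
    rw [hn]; ring
  subst h2
  simp

theorem continuousOn_int_of_complex {X : Type*} [TopologicalSpace X] {n : X → ℤ} {s : Set X}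
    {f : X → ℂ} (hf : ContinuousOn f s) (h : ∀ x ∈ s, ((n x : ℤ) : ℂ) = f x) :
    ContinuousOn n s := by
  rw [Int.isClosedEmbedding_coe_real.isInducing.continuousOn_iff]
  refine (Complex.continuous_re.comp_continuousOn hf).congr fun x hx => ?_
  simp [← h x hx]

theorem cechD_one_apply {B : Type*} [TopologicalSpace B] {A : Type*} [AddCommGroup A] (ℓ : (Fin 2 → B) → B → A) (x : Fin 3 → B)
    (b : B) :
    cechD B A 1 ℓ x b = ℓ ![x 1, x 2] b - ℓ ![x 0, x 2] b + ℓ ![x 0, x 1] b := by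
  have h0 : (fun j => x ((0 : Fin 3).succAbove j)) = ![x 1, x 2] := by
    funext j; fin_cases j <;> rfl
  have h1 : (fun j => x ((1 : Fin 3).succAbove j)) = ![x 0, x 2] := by
    funext j; fin_cases j <;> rfl
  have h2 : (fun j => x ((2 : Fin 3).succAbove j)) = ![x 0, x 1] := by
    funext j; fin_cases j <;> rfl
  have e : cechD B A 1 ℓ x b =
      ∑ i : Fin 3, (-1 : ℤ) ^ (i : ℕ) • ℓ (fun j => x (i.succAbove j)) b := rfl
  rw [e, Fin.sum_univ_three, h0, h1, h2]
  simp [sub_eq_add_neg]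

theorem cechD_cechD (ℓ : (Fin 2 → B) → B → ℂ) (x : Fin 4 → B) (b : B) :
    cechD B ℂ 2 (cechD B ℂ 1 ℓ) x b = 0 := by
  have e : cechD B ℂ 2 (cechD B ℂ 1 ℓ) x b =
      ∑ i : Fin 4, (-1 : ℤ) ^ (i : ℕ) • cechD B ℂ 1 ℓ (fun j => x (i.succAbove j)) b := rfl
  have a0 : (0 : Fin 4).succAbove 0 = 1 ∧ (0 : Fin 4).succAbove 1 = 2 ∧
    (0 : Fin 4).succAbove 2 = 3 := by decide
  have a1 : (1 : Fin 4).succAbove 0 = 0 ∧ (1 : Fin 4).succAbove 1 = 2 ∧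
    (1 : Fin 4).succAbove 2 = 3 := by decide
  have a2 : (2 : Fin 4).succAbove 0 = 0 ∧ (2 : Fin 4).succAbove 1 = 1 ∧
    (2 : Fin 4).succAbove 2 = 3 := by decide
  have a3 : (3 : Fin 4).succAbove 0 = 0 ∧ (3 : Fin 4).succAbove 1 = 1 ∧
    (3 : Fin 4).succAbove 2 = 2 := by decide
  rw [e, Fin.sum_univ_four]
  simp only [cechD_one_apply, a0, a1, a2, a3]
  simp
  ring

/-- Every complex vector bundle over a paracompact Hausdorff space has exactly one first Chern
class. -/
theorem existsUnique_isFirstChernClass [FiniteDimensional ℂ F] [T2Space B] [ParacompactSpace B] :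
    ∃! c : CechH B ℤ 2, IsFirstChernClass F E c := by
  have key : ∃ c : CechH B ℤ 2, IsFirstChernClass F E c := by
    set u : B → Set B := fun x => (trivializationAt F E x).baseSet with hu
    have huo : ∀ x, IsOpen (u x) := fun x => (trivializationAt F E x).open_baseSet
    have hux : ∀ x, x ∈ u x := fun x => mem_baseSet_trivializationAt F E x
    set g := detTransition F E with hg
    obtain ⟨v, hvo, hvc, hvf, hvu⟩ := precise_refinement u huo
      (Set.eq_univ_of_forall fun x => Set.mem_iUnion.2 ⟨x, hux x⟩)
    obtain ⟨v', hv'c, hv'o, hv'v⟩ := exists_iUnion_eq_closure_subset hvo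
      (fun x => hvf.point_finite x) hvc
    have hFf : LocallyFinite fun c => closure (v' c) := hvf.subset hv'v
    have ha : ∀ x, ∃ a, x ∈ v' a := fun x => by
      have : x ∈ ⋃ a, v' a := by rw [hv'c]; trivial
      exact Set.mem_iUnion.1 this
    choose a ha using ha
    have gne : ∀ x y b, b ∈ u x → b ∈ u y → g x y b ≠ 0 := by
      intro x y b hx hy h0
      have h1 := detTransition_cocycle (F := F) (E := E) hx hy hx
      rw [detTransition_self hx] at h1
      rw [hg] at h0
      rw [h0, zero_mul] at h1
      exact zero_ne_one h1
    have hP : ∀ x, ∀ᶠ b in nhds x, ∀ c, (b ∈ closure (v' c) → x ∈ closure (v' c)) ∧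
        (x ∈ closure (v' c) → b ∈ u c ∧ g x c b / g x c x ∈ Complex.slitPlane) := by
      intro x
      obtain ⟨t, ht, htf⟩ := hFf x
      have h1 : ∀ᶠ b in nhds x, ∀ c ∈ {c | (closure (v' c) ∩ t).Nonempty},
          (b ∈ closure (v' c) → x ∈ closure (v' c)) ∧
          (x ∈ closure (v' c) → b ∈ u c ∧ g x c b / g x c x ∈ Complex.slitPlane) := by
        rw [Filter.eventually_all_finite htf]
        intro c _
        by_cases hxc : x ∈ closure (v' c)
        · have hxu : x ∈ u c := hvu c (hv'v c hxc)
          have hcont : ContinuousAt (fun b => g x c b / g x c x) x :=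
            ((continuousOn_detTransition x c).continuousAt
              (((huo c).inter (huo x)).mem_nhds ⟨hxu, hux x⟩)).div_const _
          have hs : Complex.slitPlane ∈ nhds (g x c x / g x c x) := by
            rw [div_self (gne x c x (hux x) hxu)]
            exact Complex.isOpen_slitPlane.mem_nhds Complex.one_mem_slitPlane
          filter_upwards [(huo c).mem_nhds hxu, hcont hs] with b hb hb'
          exact ⟨fun _ => hxc, fun _ => ⟨hb, hb'⟩⟩
        · filter_upwards [isClosed_closure.isOpen_compl.mem_nhds hxc] with b hb
          exact ⟨fun h => absurd h hb, fun h => absurd h hxc⟩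
      filter_upwards [h1, ht] with b hb hbt c
      by_cases hc : (closure (v' c) ∩ t).Nonempty
      · exact hb c hc
      · exact ⟨fun h => absurd ⟨b, h, hbt⟩ hc, fun h => absurd ⟨x, h, mem_of_mem_nhds ht⟩ hc⟩
    have hO : ∀ x, ∃ O : Set B, (∀ b ∈ O, ∀ c, (b ∈ closure (v' c) → x ∈ closure (v' c)) ∧
        (x ∈ closure (v' c) → b ∈ u c ∧ g x c b / g x c x ∈ Complex.slitPlane)) ∧
        IsOpen O ∧ x ∈ O := fun x => eventually_nhds_iff.1 (hP x)
    choose O hO1 hO2 hO3 using hO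
    set V : B → Set B := fun x => u x ∩ v' (a x) ∩ O x with hV
    have hVp : IsPointedCover V := fun x =>
      ⟨((huo x).inter (hv'o _)).inter (hO2 x), ⟨hux x, ha x⟩, hO3 x⟩
    set N : B → B → B → ℂ := fun x c b =>
      Complex.log (g x c b / g x c x) + Complex.log (g x c x) with hN
    have hNe : ∀ x c b, b ∈ V x → x ∈ closure (v' c) → Complex.exp (N x c b) = g x c b := by
      intro x c b hb hx
      have h1 := gne x c x (hux x) (hvu c (hv'v c hx))
      have h2 := gne x c b hb.1.1 ((hO1 x b hb.2 c).2 hx).1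
      rw [hN, Complex.exp_add, Complex.exp_log (div_ne_zero h2 h1), Complex.exp_log h1,
        div_mul_cancel₀ _ h1]
    have hNc : ∀ x c, x ∈ closure (v' c) → ContinuousOn (N x c) (V x) := by
      intro x c hx
      refine ContinuousOn.add (ContinuousOn.clog ?_ ?_) continuousOn_const
      · exact ((continuousOn_detTransition x c).mono
          fun b hb => ⟨((hO1 x b hb.2 c).2 hx).1, hb.1.1⟩).div_const _
      · exact fun b hb => ((hO1 x b hb.2 c).2 hx).2
    have hmeet : ∀ x y b, b ∈ V x → b ∈ V y → x ∈ closure (v' (a y)) := fun x y b hx hy =>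
      (hO1 x b hx.2 (a y)).1 (subset_closure hy.1.2)
    set ℓ : (Fin 2 → B) → B → ℂ := fun x b =>
      (N (x 0) (a (x 1)) b - N (x 1) (a (x 1)) b) / (2 * Real.pi * Complex.I) with hℓ
    have hℓc : ∀ x, ContinuousOn (ℓ x) {b | ∀ i, b ∈ V (x i)} := by
      intro x b hb
      refine ContinuousWithinAt.div_const (ContinuousWithinAt.sub ?_ ?_) _
      · exact ((hNc _ _ (hmeet _ _ b (hb 0) (hb 1))) b (hb 0)).mono fun b' hb' => hb' 0
      · exact ((hNc _ _ (hmeet _ _ b (hb 1) (hb 1))) b (hb 1)).mono fun b' hb' => hb' 1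
    have hℓe : ∀ x b, (∀ i, b ∈ V (x i)) →
        Complex.exp (2 * Real.pi * Complex.I * ℓ x b) = g (x 0) (x 1) b := by
      intro x b hb
      rw [hℓ]
      simp only
      rw [mul_div_cancel₀ _ Complex.two_pi_I_ne_zero, Complex.exp_sub,
        hNe _ _ b (hb 0) (hmeet _ _ b (hb 0) (hb 1)),
        hNe _ _ b (hb 1) (hmeet _ _ b (hb 1) (hb 1))]
      have hc : b ∈ u (a (x 1)) :=
        hvu _ (hv'v _ (subset_closure (hb 1).1.2))
      rw [div_eq_iff (gne _ _ b (hb 1).1.1 hc)]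
      exact (detTransition_cocycle (hb 0).1.1 (hb 1).1.1 hc).symm
    set z : (Fin 3 → B) → B → ℤ := fun x b => round (cechD B ℂ 1 ℓ x b).re with hz
    have hze : ∀ x b, (∀ i, b ∈ V (x i)) → ((z x b : ℤ) : ℂ) = cechD B ℂ 1 ℓ x b := by
      intro x b hb
      apply exp_eq_one_iff_int
      have e1 := hℓe ![x 1, x 2] b (by intro i; fin_cases i <;> simp [hb])
      have e2 := hℓe ![x 0, x 2] b (by intro i; fin_cases i <;> simp [hb])
      have e3 := hℓe ![x 0, x 1] b (by intro i; fin_cases i <;> simp [hb])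
      simp only [Matrix.cons_val_zero, Matrix.cons_val_one] at e1 e2 e3
      rw [cechD_one_apply, mul_add, mul_sub, Complex.exp_add, Complex.exp_sub, e1, e2, e3]
      have := detTransition_cocycle (F := F) (E := E) (hb 0).1.1 (hb 1).1.1 (hb 2).1.1
      rw [div_mul_eq_mul_div, mul_comm, hg, this,
        div_self (gne _ _ b (hb 0).1.1 (hb 2).1.1)]
    have hzc : z ∈ cechCocycles B ℤ 2 := by
      refine ⟨⟨V, hVp, fun x => ?_⟩, V, hVp, fun x b hb => ?_⟩
      · refine continuousOn_int_of_complex (f := cechD B ℂ 1 ℓ x) ?_ (fun b hb => hze x b hb)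
        have : ∀ i j, ContinuousOn (ℓ ![x i, x j]) {b | ∀ i, b ∈ V (x i)} := fun i j =>
          (hℓc ![x i, x j]).mono fun b hb k => by fin_cases k <;> simp [hb _]
        refine (((this 1 2).sub (this 0 2)).add (this 0 1)).congr fun b _ => ?_
        rw [cechD_one_apply]; rfl
      · have h1 : ((cechD B ℤ 2 z x b : ℤ) : ℂ) = cechD B ℂ 2 (cechD B ℂ 1 ℓ) x b := by
          have e1 : cechD B ℤ 2 z x b =
            ∑ i : Fin 4, (-1 : ℤ) ^ (i : ℕ) • z (fun j => x (i.succAbove j)) b := rfl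
          have e2 : cechD B ℂ 2 (cechD B ℂ 1 ℓ) x b =
            ∑ i : Fin 4, (-1 : ℤ) ^ (i : ℕ) • cechD B ℂ 1 ℓ (fun j => x (i.succAbove j)) b := rfl
          rw [e1, e2, Int.cast_sum]
          refine Finset.sum_congr rfl fun i _ => ?_
          rw [← hze _ b fun j => hb _]
          simp
        rw [cechD_cechD] at h1
        exact_mod_cast h1
    exact ⟨_, V, hVp, fun x b hb => hb.1.1, ℓ, hℓc, hℓe, ⟨z, hzc⟩, rfl, hze⟩
  refine existsUnique_of_exists_of_unique key ?_
  rintro c c' ⟨U, hU, hUb, ℓ, hℓ, he, z, rfl, hz⟩ ⟨U', hU', hUb', ℓ', hℓ', he', z', rfl, hz'⟩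
  rw [QuotientAddGroup.eq_iff_sub_mem, AddSubgroup.mem_addSubgroupOf]
  have hW := hU.inter hU'
  set n : (Fin 2 → B) → B → ℤ := fun x b => round (ℓ x b - ℓ' x b).re with hn
  have hne : ∀ x b, (∀ i, b ∈ U (x i) ∩ U' (x i)) → ((n x b : ℤ) : ℂ) = ℓ x b - ℓ' x b := by
    intro x b hb
    apply exp_eq_one_iff_int
    rw [mul_sub, Complex.exp_sub, he x b fun i => (hb i).1, he' x b fun i => (hb i).2]
    apply div_self
    rw [← he x b fun i => (hb i).1]
    exact Complex.exp_ne_zero _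
  refine AddSubgroup.mem_sup.2 ⟨cechD B ℤ 1 n, ⟨n, ⟨_, hW, fun x => ?_⟩, rfl⟩,
    (z - z').1 - cechD B ℤ 1 n, ⟨_, hW, fun x b hb => ?_⟩, by abel⟩
  · refine continuousOn_int_of_complex (f := fun b => ℓ x b - ℓ' x b) ?_ (fun b hb => hne x b hb)
    exact ((hℓ x).mono fun b hb i => (hb i).1).sub ((hℓ' x).mono fun b hb i => (hb i).2)
  · have h1 : ((cechD B ℤ 1 n x b : ℤ) : ℂ) = cechD B ℂ 1 ℓ x b - cechD B ℂ 1 ℓ' x b := by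
      rw [cechD_one_apply, cechD_one_apply, cechD_one_apply]
      have e : ∀ i j, ((n ![x i, x j] b : ℤ) : ℂ) = ℓ ![x i, x j] b - ℓ' ![x i, x j] b :=
        fun i j => hne _ b fun k => by fin_cases k <;> simp [(hb _).1, (hb _).2]
      push_cast
      rw [e, e, e]; ring
    rw [← hz x b fun i => (hb i).1, ← hz' x b fun i => (hb i).2] at h1
    have h2 : cechD B ℤ 1 n x b = z.1 x b - z'.1 x b := by exact_mod_cast h1
    simp [h2]

variable (F E)

/-- The first Chern class `c₁(E) ∈ Ȟ²(B; ℤ)` of a complex vector bundle `E` over a paracompact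
Hausdorff space `B`. -/
def firstChernClass [FiniteDimensional ℂ F] [T2Space B] [ParacompactSpace B] : CechH B ℤ 2 :=
  (existsUnique_isFirstChernClass (F := F) (E := E)).choose

end Chern

/-! ### Simple polytopes and combinatorial quasitoric pairs -/

/-- A convex polytope in `ℝⁿ` presented by `m` half-spaces `⟨aⱼ, x⟩ + bⱼ ≥ 0` with inward pointing
unit normals `aⱼ`. -/
structure HalfspaceSystem (n m : ℕ) where
  normal : Fin m → EuclideanSpace ℝ (Fin n)
  offset : Fin m → ℝ
  norm_normal : ∀ j, ‖normal j‖ = 1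

namespace HalfspaceSystem

variable {n m : ℕ} (P : HalfspaceSystem n m)

/-- The signed distance from the `j`-th bounding hyperplane, i.e. the `j`-th coordinate of the map
`i_P(x) = A_P x + b_P`. -/
def dist (j : Fin m) (x : EuclideanSpace ℝ (Fin n)) : ℝ := ⟪P.normal j, x⟫ + P.offset j

/-- The intersection of the half-spaces. -/
def carrier : Set (EuclideanSpace ℝ (Fin n)) := {x | ∀ j, 0 ≤ P.dist j x}

/-- The `j`-th facet. -/
def facet (j : Fin m) : Set (EuclideanSpace ℝ (Fin n)) := {x ∈ P.carrier | P.dist j x = 0}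

end HalfspaceSystem

/-- A simple `n`-dimensional polytope with `m` facets: the half-spaces are irredundant, their
intersection is bounded and `n`-dimensional, and every vertex lies on exactly `n` facets. -/
structure SimplePolytope (n m : ℕ) extends HalfspaceSystem n m where
  bounded : Bornology.IsBounded toHalfspaceSystem.carrier
  interior_nonempty : (interior toHalfspaceSystem.carrier).Nonempty
  irredundant : ∀ j, ∃ x, (∀ i, i ≠ j → 0 ≤ toHalfspaceSystem.dist i x) ∧
    toHalfspaceSystem.dist j x < 0
  simple : ∀ v ∈ toHalfspaceSystem.carrier.extremePoints ℝ,
    {j | v ∈ toHalfspaceSystem.facet j}.ncard = n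

/-- A combinatorial quasitoric pair `(P, Λ)`: an oriented simple polytope with finely ordered
facets (the first `n` of them meet in the initial vertex), and a refined integral `n × m` matrix
`Λ`: its first `n` columns form the identity matrix, and `det (λ_{j₁} … λ_{jₙ}) = ±1` whenever
`F_{j₁} ∩ … ∩ F_{jₙ}` is a vertex. The orientation of `P`, with the signs of the columns of `Λ`,
gives the omniorientation. -/
structure QuasitoricPair (n m : ℕ) extends SimplePolytope n m where
  orientation : Orientation ℝ (EuclideanSpace ℝ (Fin n)) (Fin n)
  le : n ≤ m
  finelyOrdered : ∃ v, ⋂ i : Fin n, toHalfspaceSystem.facet (Fin.castLE le i) = {v}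
  Λ : Matrix (Fin n) (Fin m) ℤ
  refined : Λ.submatrix id (Fin.castLE le) = 1
  unimodular : ∀ f : Fin n → Fin m, (∃ v, ⋂ i, toHalfspaceSystem.facet (f i) = {v}) →
    (Λ.submatrix id f).det = 1 ∨ (Λ.submatrix id f).det = -1

namespace HalfspaceSystem

variable {n m : ℕ} (P : HalfspaceSystem n m)

theorem continuous_dist (j : Fin m) : Continuous (P.dist j) := by
  unfold HalfspaceSystem.dist
  fun_prop

theorem isClosed_carrier : IsClosed P.carrier := by
  have : P.carrier = ⋂ j, {x | 0 ≤ P.dist j x} := by ext; simp [carrier]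
  rw [this]
  exact isClosed_iInter fun j => isClosed_le continuous_const (P.continuous_dist j)

theorem dist_combo (j : Fin m) (x y : EuclideanSpace ℝ (Fin n)) (a b : ℝ) (h : a + b = 1) :
    P.dist j (a • x + b • y) = a * P.dist j x + b * P.dist j y := by
  simp only [dist, inner_add_right, inner_smul_right]
  linear_combination (-P.offset j) * h

end HalfspaceSystem

namespace SimplePolytope

variable {n m : ℕ} (P : SimplePolytope n m)

theorem isCompact_carrier : IsCompact P.carrier :=
  Metric.isCompact_of_isClosed_isBounded P.isClosed_carrier P.bounded

/-- The normals of the facets through a vertex span `ℝⁿ`. -/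
theorem eq_zero_of_vertex {v : EuclideanSpace ℝ (Fin n)} (hv : v ∈ P.carrier.extremePoints ℝ)
    (u : EuclideanSpace ℝ (Fin n)) (hu : ∀ j, v ∈ P.facet j → ⟪P.normal j, u⟫ = 0) : u = 0 := by
  have h1 : ∀ w, (∀ j, v ∈ P.facet j → ⟪P.normal j, w⟫ = 0) →
      ∀ᶠ ε in nhds (0 : ℝ), v + ε • w ∈ P.carrier := by
    intro w hw
    have : ∀ j, ∀ᶠ ε in nhds (0 : ℝ), 0 ≤ P.dist j (v + ε • w) := by
      intro j
      by_cases hj : v ∈ P.facet j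
      · refine Filter.Eventually.of_forall fun ε => ?_
        have h0 : P.dist j v = 0 := hj.2
        have : P.dist j (v + ε • w) = P.dist j v := by
          simp [HalfspaceSystem.dist, inner_add_right, inner_smul_right, hw j hj]
        rw [this, h0]
      · have hpos : 0 < P.dist j v := lt_of_le_of_ne (hv.1 j) fun h => hj ⟨hv.1, h.symm⟩
        have hc : Continuous fun ε : ℝ => P.dist j (v + ε • w) :=
          (P.continuous_dist j).comp (by fun_prop)
        have := hc.continuousAt.eventually (lt_mem_nhds (a := (0:ℝ)) (b := P.dist j (v + (0:ℝ) • w))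
          (by simpa using hpos))
        exact this.mono fun ε h => h.le
    exact (Filter.eventually_all.2 this).mono fun ε h => h
  have h2 := (h1 u hu).and (h1 (-u) fun j hj => by rw [inner_neg_right, hu j hj, neg_zero])
  obtain ⟨ε, ⟨h3, h4⟩, hε⟩ := ((h2.filter_mono nhdsWithin_le_nhds).and
    (self_mem_nhdsWithin (a := (0:ℝ)) (s := Set.Ioi 0))).exists
  have h5 := (mem_extremePoints.1 hv).2 _ h3 _ h4
    ⟨1/2, 1/2, by norm_num, by norm_num, by norm_num, by module⟩
  have h6 : ε • u = 0 := by simpa using h5.1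
  exact (smul_eq_zero.1 h6).resolve_left (ne_of_gt hε)

/-- Every point `p` of `P` has a set of `n` facets which meet in a vertex, contain all the facets
through `p`, and have linearly independent normals. -/
theorem exists_vertex {p : EuclideanSpace ℝ (Fin n)} (hp : p ∈ P.carrier) :
    ∃ f : Fin n → Fin m, (∃ v, ⋂ i, P.facet (f i) = {v}) ∧
      (∀ j, P.dist j p = 0 → j ∈ Set.range f) ∧ LinearIndependent ℝ (fun i => P.normal (f i)) := by
  set G : Set (EuclideanSpace ℝ (Fin n)) := {x ∈ P.carrier | ∀ j, P.dist j p = 0 → P.dist j x = 0}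
    with hG
  have hGc : IsCompact G := by
    refine P.isCompact_carrier.of_isClosed_subset ?_ fun x hx => hx.1
    have : G = P.carrier ∩ ⋂ j, ⋂ (_ : P.dist j p = 0), {x | P.dist j x = 0} := by
      ext; simp [hG]
    rw [this]
    exact P.isClosed_carrier.inter (isClosed_iInter fun j => isClosed_iInter fun _ =>
      isClosed_eq (P.continuous_dist j) continuous_const)
  obtain ⟨v, hv⟩ := hGc.extremePoints_nonempty ⟨p, hp, fun _ h => h⟩
  have hGe : IsExtreme ℝ P.carrier G := by
    refine ⟨fun x hx => hx.1, ?_⟩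
    rintro x hx y hy z hz ⟨a, b, ha, hb, hab, rfl⟩
    refine ⟨hx, fun j hj => ?_⟩
    have h1 := hz.2 j hj
    rw [P.dist_combo j x y a b hab] at h1
    have h2 := hx j
    have h3 := mul_nonneg hb.le (hy j)
    have h4 := mul_nonneg ha.le h2
    have h5 : a * P.dist j x = 0 := by linarith
    exact (mul_eq_zero.1 h5).resolve_left ha.ne'
  have hvP := hGe.extremePoints_subset_extremePoints hv
  have hcard := P.simple v hvP
  set J : Finset (Fin m) := (Set.toFinite {j | v ∈ P.facet j}).toFinset with hJ
  have hJc : J.card = n := by rw [← hcard, Set.ncard_eq_toFinset_card _ (Set.toFinite _)]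
  set f := J.orderEmbOfFin hJc with hf
  have hfr : Set.range f = {j | v ∈ P.facet j} := by
    rw [hf, Finset.range_orderEmbOfFin, hJ]; simp
  have hfm : ∀ i, v ∈ P.facet (f i) := fun i => by
    have : f i ∈ Set.range f := ⟨i, rfl⟩
    rw [hfr] at this; exact this
  have hspan : ∀ u, (∀ i, ⟪P.normal (f i), u⟫ = 0) → u = 0 := by
    intro u hu
    refine P.eq_zero_of_vertex hvP u fun j hj => ?_
    have : j ∈ Set.range f := by rw [hfr]; exact hj
    obtain ⟨i, rfl⟩ := this
    exact hu i
  refine ⟨f, ⟨v, ?_⟩, ?_, ?_⟩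
  · ext w
    simp only [Set.mem_iInter, Set.mem_singleton_iff]
    refine ⟨fun hw => ?_, fun hw => hw ▸ hfm⟩
    rw [← sub_eq_zero]
    refine hspan _ fun i => ?_
    have h1 := (hw i).2
    have h2 := (hfm i).2
    simp only [HalfspaceSystem.dist] at h1 h2
    rw [inner_sub_right]; linarith
  · intro j hj
    rw [hfr]
    exact ⟨hvP.1, hv.1.2 j hj⟩
  · refine linearIndependent_of_top_le_span_of_card_eq_finrank ?_ (by simp)
    rw [top_le_iff, ← Submodule.orthogonal_eq_bot_iff, Submodule.eq_bot_iff]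
    intro u hu
    exact hspan u fun i => (Submodule.mem_orthogonal _ _).1 hu _ (Submodule.subset_span ⟨i, rfl⟩)

end SimplePolytope

/-! ### Moment-angle manifolds and quasitoric manifolds -/

/-- The standard (coordinatewise) action of `Tᵐ` on `ℂᵐ`. -/
def rot {m : ℕ} (t : Fin m → Circle) (v : Fin m → ℂ) : Fin m → ℂ := fun j => t j * v j

section Rot

variable {m : ℕ}

@[simp] theorem rot_apply (t : Fin m → Circle) (v : Fin m → ℂ) (j : Fin m) :
    rot t v j = t j * v j := rfl

@[simp] theorem rot_one (v : Fin m → ℂ) : rot 1 v = v := by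
  funext j; simp

theorem rot_mul (s t : Fin m → Circle) (v : Fin m → ℂ) : rot (s * t) v = rot s (rot t v) := by
  funext j; simp [mul_assoc]

theorem rot_add (t : Fin m → Circle) (v w : Fin m → ℂ) : rot t (v + w) = rot t v + rot t w := by
  funext j; simp [mul_add]

theorem rot_smul (t : Fin m → Circle) (c : ℂ) (v : Fin m → ℂ) : rot t (c • v) = c • rot t v := by
  funext j; simp; ring

theorem continuous_rot : Continuous fun x : (Fin m → Circle) × (Fin m → ℂ) => rot x.1 x.2 := by
  unfold rot
  fun_prop

theorem continuousAt_rot {X : Type*} [TopologicalSpace X] {f : X → (Fin m → Circle)}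
    {g : X → (Fin m → ℂ)} {x : X} (hf : ContinuousAt f x) (hg : ContinuousAt g x) :
    ContinuousAt (fun y => rot (f y) (g y)) x :=
  ContinuousAt.comp (f := fun y => (f y, g y)) continuous_rot.continuousAt (hf.prodMk hg)

@[simp] theorem rot_inv_rot (t : Fin m → Circle) (v : Fin m → ℂ) : rot t⁻¹ (rot t v) = v := by
  rw [← rot_mul]; simp

@[simp] theorem rot_rot_inv (t : Fin m → Circle) (v : Fin m → ℂ) : rot t (rot t⁻¹ v) = v := by
  rw [← rot_mul]; simp

end Rot

/-- The homomorphism of tori `Tᵇ → Tᵃ` defined by an integral `a × b` matrix. -/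
def torusHom {a b : ℕ} (N : Matrix (Fin a) (Fin b) ℤ) : (Fin b → Circle) →* (Fin a → Circle) where
  toFun t := fun i => ∏ j, t j ^ N i j
  map_one' := by funext i; simp
  map_mul' s t := by funext i; simp [mul_zpow, Finset.prod_mul_distrib]

theorem torusHom_apply {a b : ℕ} (N : Matrix (Fin a) (Fin b) ℤ) (t : Fin b → Circle) (i : Fin a) :
    torusHom N t i = ∏ j, t j ^ N i j := rfl

theorem continuous_torusHom {a b : ℕ} (N : Matrix (Fin a) (Fin b) ℤ) :
    Continuous (torusHom N) := by
  refine continuous_pi fun i => ?_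
  simp only [torusHom_apply]
  exact continuous_finsetProd _ fun j _ => (continuous_apply j).zpow _

theorem torusHom_mul {a b c : ℕ} (N : Matrix (Fin a) (Fin b) ℤ) (N' : Matrix (Fin b) (Fin c) ℤ)
    (t : Fin c → Circle) : torusHom (N * N') t = torusHom N (torusHom N' t) := by
  have hz : ∀ (x : Circle) {ι : Type} (s : Finset ι) (f : ι → ℤ),
      x ^ (∑ i ∈ s, f i) = ∏ i ∈ s, x ^ f i := by
    intro x ι s f
    classical
    induction s using Finset.induction_on with
    | empty => simp
    | insert i s hi ih => rw [Finset.sum_insert hi, Finset.prod_insert hi, zpow_add, ih]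
  funext i
  simp only [torusHom_apply, Matrix.mul_apply, hz]
  rw [Finset.prod_comm]
  refine Finset.prod_congr rfl fun j _ => ?_
  have : ∀ (s : Finset (Fin c)) (f : Fin c → Circle) (k : ℤ),
      (∏ x ∈ s, f x) ^ k = ∏ x ∈ s, f x ^ k := fun s f k => by
    rw [Finset.prod_zpow]
  rw [this]
  refine Finset.prod_congr rfl fun k _ => ?_
  rw [← zpow_mul, mul_comm]

theorem torusHom_one {a : ℕ} (t : Fin a → Circle) :
    torusHom (1 : Matrix (Fin a) (Fin a) ℤ) t = t := by
  funext i
  rw [torusHom_apply, Finset.prod_eq_single i]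
  · simp
  · intro j _ hj
    rw [Matrix.one_apply_ne hj.symm, zpow_zero]
  · simp

/-- The moment-angle manifold `Z_P`, the pullback of `i_P : P → ℝᵐ` along
`μ : ℂᵐ → ℝᵐ, μ(z) = (|z₁|², …, |z_m|²)`. -/
def HalfspaceSystem.momentAngle {n m : ℕ} (P : HalfspaceSystem n m) :
    Set (EuclideanSpace ℝ (Fin n) × (Fin m → ℂ)) :=
  {x | x.1 ∈ P.carrier ∧ ∀ j, ‖x.2 j‖ ^ 2 = P.dist j x.1}

namespace QuasitoricPair

variable {n m : ℕ} (Q : QuasitoricPair n m)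

/-- The moment-angle manifold of the underlying polytope, as a space. -/
abbrev Z : Type := Q.momentAngle

/-- The embedding `i_Z : Z_P → ℂᵐ`. -/
def coord (z : Q.Z) : Fin m → ℂ := z.1.2

theorem continuous_coord : Continuous Q.coord := continuous_snd.comp continuous_subtype_val

/-- The standard action of `Tᵐ` on `Z_P`. -/
instance : MulAction (Fin m → Circle) Q.Z where
  smul t z := ⟨(z.1.1, rot t z.1.2), z.2.1, fun j => by
    have h : ‖rot t z.1.2 j‖ = ‖z.1.2 j‖ := by
      rw [rot_apply, norm_mul, Circle.norm_coe, one_mul]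
    rw [← z.2.2 j, h]⟩
  one_smul z := Subtype.ext (Prod.ext rfl (rot_one _))
  mul_smul s t z := Subtype.ext (Prod.ext rfl (rot_mul _ _ _))

theorem coord_smul (t : Fin m → Circle) (z : Q.Z) : Q.coord (t • z) = rot t (Q.coord z) := rfl

instance : ContinuousSMul (Fin m → Circle) Q.Z where
  continuous_smul := by
    refine Continuous.subtype_mk (Continuous.prodMk ?_ ?_) _
    · exact (continuous_fst.comp continuous_subtype_val).comp continuous_snd
    · exact continuous_rot.comp (continuous_fst.prodMk
        ((continuous_snd.comp continuous_subtype_val).comp continuous_snd))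

instance : CompactSpace Q.Z := by
  rw [← isCompact_iff_compactSpace]
  obtain ⟨R, hR⟩ := Q.isCompact_carrier.exists_bound_of_continuousOn
    (f := fun x => fun j => Q.dist j x)
    (continuous_pi fun j => Q.continuous_dist j).continuousOn
  have hb : IsCompact (Metric.closedBall (0 : Fin m → ℂ) (R + 1)) := isCompact_closedBall _ _
  refine (Q.isCompact_carrier.prod hb).of_isClosed_subset ?_ ?_
  · have : Q.momentAngle = (Prod.fst ⁻¹' Q.carrier) ∩
        ⋂ j, {x : EuclideanSpace ℝ (Fin n) × (Fin m → ℂ) | ‖x.2 j‖ ^ 2 = Q.dist j x.1} := by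
      ext; simp [HalfspaceSystem.momentAngle]
    rw [this]
    refine (Q.isClosed_carrier.preimage continuous_fst).inter (isClosed_iInter fun j =>
      isClosed_eq (by fun_prop) ((Q.continuous_dist j).comp continuous_fst))
  · rintro ⟨p, z⟩ ⟨hp, hz⟩
    refine ⟨hp, ?_⟩
    have h1 := hR p hp
    have h0 : 0 ≤ R := (norm_nonneg _).trans h1
    rw [mem_closedBall_zero_iff, pi_norm_le_iff_of_nonneg (by linarith)]
    intro j
    have h2 : ‖z j‖ ^ 2 ≤ R := by
      have h3 := (norm_le_pi_norm (fun j => Q.dist j p) j).trans h1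
      rw [hz j]
      exact (le_abs_self _).trans h3
    nlinarith [norm_nonneg (z j)]

/-- The kernel `K(Λ)` of the epimorphism `Λ : Tᵐ → Tⁿ`. -/
def K : Subgroup (Fin m → Circle) := (torusHom Q.Λ).ker

/-- The quasitoric manifold `M(P, Λ) = Z_P / K(Λ)`, with the quotient topology. -/
abbrev M : Type := MulAction.orbitRel.Quotient Q.K Q.Z

/-- The projection `Z_P → M(P, Λ)`. -/
def proj (z : Q.Z) : Q.M := Quotient.mk _ z

theorem isOpenQuotientMap_proj : IsOpenQuotientMap Q.proj :=
  MulAction.isOpenQuotientMap_quotientMk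

theorem proj_eq_iff {z z' : Q.Z} : Q.proj z' = Q.proj z ↔ ∃ t : Q.K, t • z = z' := Quotient.eq

theorem proj_smul (t : Q.K) (z : Q.Z) : Q.proj (t • z) = Q.proj z := Q.proj_eq_iff.2 ⟨t, rfl⟩

theorem isClosed_K : IsClosed (Q.K : Set (Fin m → Circle)) :=
  isClosed_singleton.preimage (continuous_torusHom Q.Λ)

instance : CompactSpace Q.K := isCompact_iff_compactSpace.1 Q.isClosed_K.isCompact

instance : T2Space Q.M := by
  have : ProperSMul Q.K Q.Z := by
    rw [properSMul_iff]
    exact (Continuous.isProperMap (by fun_prop))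
  infer_instance

/-- Local slices for the action of `K` on `Z_P`. -/
theorem exists_slice (z₀ : Q.Z) : ∃ (k : Q.Z → Q.K) (V : Set Q.Z), IsOpen V ∧ z₀ ∈ V ∧
    ContinuousOn k V ∧ ∀ z ∈ V, ∀ t : Q.K, t • z ∈ V ∧ k (t • z) = k z * t⁻¹ := by
  obtain ⟨f, hfv, hfr, -⟩ := Q.exists_vertex z₀.2.1
  have hdet : IsUnit (Q.Λ.submatrix id f).det := by
    rcases Q.unimodular f hfv with h | h <;> rw [h] <;> simp
  set L := Q.Λ.submatrix id f with hL
  set R : Matrix (Fin m) (Fin n) ℤ := Matrix.of fun j i => if j = f i then 1 else 0 with hR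
  have hΛR : Q.Λ * R = L := by
    ext i k
    simp [Matrix.mul_apply, hR, hL]
  set S := R * L⁻¹ with hS
  have hΛS : Q.Λ * S = 1 := by
    rw [hS, ← Matrix.mul_assoc, hΛR, Matrix.mul_nonsing_inv _ hdet]
  have hSR : S * Q.Λ * R = R := by
    rw [hS, Matrix.mul_assoc, hΛR, Matrix.mul_assoc, Matrix.nonsing_inv_mul _ hdet, Matrix.mul_one]
  have hSΛ : ∀ j i, (S * Q.Λ) j (f i) = if j = f i then 1 else 0 := by
    intro j i
    have := congrFun (congrFun hSR j) i
    simpa [Matrix.mul_apply (M := S * Q.Λ), hR] using this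
  set q : (Fin m → Circle) → (Fin m → Circle) := fun t => t * (torusHom (S * Q.Λ) t)⁻¹ with hq
  have hqK : ∀ t, q t ∈ Q.K := by
    intro t
    rw [K, MonoidHom.mem_ker, hq]
    simp only [map_mul, map_inv]
    rw [← torusHom_mul, ← Matrix.mul_assoc, hΛS, Matrix.one_mul, mul_inv_cancel]
  have hqmul : ∀ s t, q (s * t) = q s * q t := by
    intro s t
    simp only [hq, map_mul, mul_inv]
    exact mul_mul_mul_comm _ _ _ _
  have hqid : ∀ t ∈ Q.K, q t = t := by
    intro t ht
    have ht' : torusHom Q.Λ t = 1 := ht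
    simp [hq, torusHom_mul, ht']
  have hq1 : ∀ t, (∀ j, j ∉ Set.range f → t j = 1) → q t = 1 := by
    intro t ht
    have : torusHom (S * Q.Λ) t = t := by
      funext j
      rw [torusHom_apply]
      have h1 : ∀ k, t k ^ (S * Q.Λ) j k = t k ^ (1 : Matrix (Fin m) (Fin m) ℤ) j k := by
        intro k
        by_cases hk : k ∈ Set.range f
        · obtain ⟨i, rfl⟩ := hk
          rw [hSΛ, Matrix.one_apply]
        · rw [ht k hk, one_zpow, one_zpow]
      simp only [h1]
      exact congrFun (torusHom_one t) j
    rw [hq]; simp [this]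
  have hqeq : ∀ s t, (∀ j, j ∉ Set.range f → s j = t j) → q s = q t := by
    intro s t h
    have h1 : q (s * t⁻¹) = 1 := hq1 _ fun j hj => by simp [h j hj]
    calc q s = q (s * t⁻¹ * t) := by simp
      _ = q t := by rw [hqmul, h1, one_mul]
  have hqc : Continuous q := continuous_id.mul (continuous_torusHom _).inv
  classical
  have hph : ∀ c : ℂ, ∃ u : Circle, c ≠ 0 → (u : ℂ) = c / ‖c‖ := by
    intro c
    by_cases h : c = 0
    · exact ⟨1, fun h' => absurd h h'⟩
    · have h' : c / ‖c‖ ∈ Submonoid.unitSphere ℂ := by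
        refine mem_sphere_zero_iff_norm.2 ?_
        simp [h]
      exact ⟨⟨c / ‖c‖, h'⟩, fun _ => rfl⟩
  choose phase hphase using hph
  set ph : Q.Z → (Fin m → Circle) := fun z j =>
    if j ∈ Set.range f then 1 else phase (Q.coord z j) with hph
  set V : Set Q.Z := {z | ∀ j, j ∉ Set.range f → Q.coord z j ≠ 0} with hV
  have hphv : ∀ z ∈ V, ∀ j, j ∉ Set.range f →
      (ph z j : ℂ) = Q.coord z j / ‖Q.coord z j‖ := by
    intro z hz j hj
    have h0 := hz j hj
    simp only [hph]
    rw [if_neg hj, hphase _ h0]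
  have hphc : ContinuousOn ph V := by
    refine continuousOn_pi.2 fun j => ?_
    by_cases hj : j ∈ Set.range f
    · simp only [hph, hj, if_true]
      exact continuousOn_const
    · have hind : Topology.IsInducing (fun u : Circle => (u : ℂ)) := ⟨rfl⟩
      rw [hind.continuousOn_iff]
      have hc : ContinuousOn (fun z => Q.coord z j) V :=
        ((continuous_apply j).comp Q.continuous_coord).continuousOn
      refine (ContinuousOn.div hc (Complex.continuous_ofReal.comp_continuousOn hc.norm)
        fun z hz => ?_).congr fun z hz => ?_
      · simpa using hz j hj
      · exact hphv z hz j hj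
  refine ⟨fun z => ⟨(q (ph z))⁻¹, inv_mem (hqK _)⟩, V, ?_, ?_, ?_, ?_⟩
  · have : V = ⋂ j, ⋂ (_ : j ∉ Set.range f), {z | Q.coord z j ≠ 0} := by
      ext; simp [hV]
    rw [this]
    refine isOpen_iInter_of_finite fun j => isOpen_iInter_of_finite fun _ => ?_
    exact isOpen_ne_fun ((continuous_apply j).comp Q.continuous_coord) continuous_const
  · intro j hj h0
    refine hj (hfr j ?_)
    rw [← z₀.2.2 j]
    have : z₀.1.2 j = 0 := h0
    simp [this]
  · rw [Topology.IsInducing.subtypeVal.continuousOn_iff]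
    exact (hqc.comp_continuousOn hphc).inv
  · intro z hz t
    have ht : ∀ j, Q.coord (t • z) j = t.1 j * Q.coord z j := fun j => rfl
    have hz' : t • z ∈ V := fun j hj => by
      rw [ht]; exact mul_ne_zero (Circle.coe_ne_zero _) (hz j hj)
    refine ⟨hz', Subtype.ext ?_⟩
    have h1 : q (ph (t • z)) = t.1 * q (ph z) := by
      have h0 : q (t.1 * ph z) = t.1 * q (ph z) := by rw [hqmul, hqid t.1 t.2]
      rw [← h0]
      refine hqeq _ _ fun j hj => ?_
      apply Circle.coe_injective
      rw [hphv _ hz' j hj, Pi.mul_apply, Circle.coe_mul, hphv z hz j hj, ht, norm_mul,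
        Circle.norm_coe, one_mul, mul_div_assoc]
    simp [h1, mul_comm]

/-- `K` acts freely on `Z_P`. -/
theorem smul_eq_self {t : Q.K} {z : Q.Z} (h : t • z = z) : t = 1 := by
  obtain ⟨k, V, -, hz, -, hk⟩ := Q.exists_slice z
  have h1 := (hk z hz t).2
  rw [h] at h1
  simpa using h1

theorem smul_left_cancel {s t : Q.K} {z : Q.Z} (h : s • z = t • z) : s = t := by
  have : (t⁻¹ * s) • z = z := by rw [mul_smul, h, inv_smul_smul]
  have := Q.smul_eq_self this
  rw [inv_mul_eq_one] at this
  exact this.symm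

end QuasitoricPair

/-! ### The complex vector bundle `ρ₁ ⊕ … ⊕ ρ_m = Z_P ×_K ℂᵐ` -/

section Bundles

open Bundle Topology

namespace QuasitoricPair

variable {n m : ℕ} (Q : QuasitoricPair n m)

/-- The fibre over `b` of the bundle `Z_P ×_K ℂᵐ → M`, as the complex vector space of
`K`-equivariant maps from the orbit over `b` to `ℂᵐ`: the class of a pair `(z, v)` under
`(t z, t v) ∼ (z, v)` corresponds to the equivariant map `f` with `f z = v` (see `mkRho`). The
summands of `ℂᵐ` give the decomposition into the line bundles `ρ₁, …, ρ_m`. -/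
def rhoSubmodule (b : Q.M) : Submodule ℂ ({z : Q.Z // Q.proj z = b} → (Fin m → ℂ)) where
  carrier := {f | ∀ z z' : {z : Q.Z // Q.proj z = b}, ∀ t : Q.K,
    t • z.1 = z'.1 → f z' = rot t (f z)}
  zero_mem' := fun z z' t _ => by funext j; simp
  add_mem' := fun {f g} hf hg z z' t h => by
    rw [Pi.add_apply, Pi.add_apply, hf z z' t h, hg z z' t h, rot_add]
  smul_mem' := fun c f hf z z' t h => by
    rw [Pi.smul_apply, Pi.smul_apply, hf z z' t h, rot_smul]

/-- The bundle `ρ₁ ⊕ … ⊕ ρ_m = Z_P ×_K ℂᵐ` over `M`. -/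
def Rho (b : Q.M) : Type := Q.rhoSubmodule b

instance (b : Q.M) : AddCommGroup (Q.Rho b) := inferInstanceAs (AddCommGroup (Q.rhoSubmodule b))
instance (b : Q.M) : Module ℂ (Q.Rho b) := inferInstanceAs (Module ℂ (Q.rhoSubmodule b))
instance (b : Q.M) : Module ℝ (Q.Rho b) := inferInstanceAs (Module ℝ (Q.rhoSubmodule b))
instance (b : Q.M) : IsScalarTower ℝ ℂ (Q.Rho b) :=
  inferInstanceAs (IsScalarTower ℝ ℂ (Q.rhoSubmodule b))
instance (b : Q.M) : TopologicalSpace (Q.Rho b) :=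
  inferInstanceAs (TopologicalSpace (Q.rhoSubmodule b))

/-- Evaluation of an element of the fibre over `b` at a point `z` of the orbit over `b`. -/
def rhoEval {b : Q.M} (z : Q.Z) (hz : Q.proj z = b) : Q.Rho b →ₗ[ℂ] (Fin m → ℂ) where
  toFun f := f.1 ⟨z, hz⟩
  map_add' _ _ := rfl
  map_smul' _ _ := rfl

theorem rhoEval_smul {b : Q.M} (z z' : Q.Z) (hz : Q.proj z = b) (hz' : Q.proj z' = b) (t : Q.K)
    (h : t • z = z') (f : Q.Rho b) : Q.rhoEval z' hz' f = rot t (Q.rhoEval z hz f) :=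
  f.2 ⟨z, hz⟩ ⟨z', hz'⟩ t h

theorem rho_ext {b : Q.M} {f g : Q.Rho b}
    (h : ∀ z hz, Q.rhoEval (b := b) z hz f = Q.rhoEval z hz g) : f = g :=
  Subtype.ext (funext fun z => h z.1 z.2)

theorem rhoEval_bijective {b : Q.M} (z : Q.Z) (hz : Q.proj z = b) :
    Function.Bijective (Q.rhoEval z hz) := by
  constructor
  · intro f g h
    refine Q.rho_ext fun z' hz' => ?_
    obtain ⟨t, ht⟩ := Q.proj_eq_iff.1 (hz'.trans hz.symm)
    rw [Q.rhoEval_smul z z' hz hz' t ht, Q.rhoEval_smul z z' hz hz' t ht, h]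
  · intro v
    have h : ∀ z' : {z : Q.Z // Q.proj z = b}, ∃ t : Q.K, t • z = z'.1 := fun z' =>
      Q.proj_eq_iff.1 (z'.2.trans hz.symm)
    choose s hs using h
    refine ⟨⟨fun z' => rot (s z') v, fun z' z'' t ht => ?_⟩, ?_⟩
    · have : s z'' = t * s z' := by
        apply Q.smul_left_cancel (z := z)
        rw [hs, mul_smul, hs, ht]
      change rot (s z'' : Fin m → Circle) v = rot t (rot (s z' : Fin m → Circle) v)
      rw [this, Subgroup.coe_mul, rot_mul]
    · have : s ⟨z, hz⟩ = 1 := Q.smul_eq_self (hs _)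
      change rot (s ⟨z, hz⟩) v = v
      rw [this]; exact rot_one v

/-- Evaluation identifies the fibre with `ℂᵐ`. -/
def rhoEquiv {b : Q.M} (z : Q.Z) (hz : Q.proj z = b) : Q.Rho b ≃ₗ[ℂ] (Fin m → ℂ) :=
  LinearEquiv.ofBijective (Q.rhoEval z hz) (Q.rhoEval_bijective z hz)

theorem rhoEquiv_apply {b : Q.M} (z : Q.Z) (hz : Q.proj z = b) (f : Q.Rho b) :
    Q.rhoEquiv z hz f = Q.rhoEval z hz f := rfl

theorem rhoEquiv_smul {b : Q.M} (z z' : Q.Z) (hz : Q.proj z = b) (hz' : Q.proj z' = b) (t : Q.K)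
    (h : t • z = z') (f : Q.Rho b) : Q.rhoEquiv z' hz' f = rot t (Q.rhoEquiv z hz f) :=
  Q.rhoEval_smul z z' hz hz' t h f

/-- The class `[z, v]` of `(z, v)` in `Z_P ×_K ℂᵐ`. -/
def mkRho (x : Q.Z × (Fin m → ℂ)) : TotalSpace (Fin m → ℂ) Q.Rho :=
  ⟨Q.proj x.1, (Q.rhoEquiv x.1 rfl).symm x.2⟩

theorem mkRho_eq {b : Q.M} (z : Q.Z) (hz : Q.proj z = b) (v : Fin m → ℂ) :
    Q.mkRho (z, v) = ⟨b, (Q.rhoEquiv z hz).symm v⟩ := by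
  subst hz; rfl

theorem mkRho_rhoEquiv {b : Q.M} (z : Q.Z) (hz : Q.proj z = b) (f : Q.Rho b) :
    Q.mkRho (z, Q.rhoEquiv z hz f) = ⟨b, f⟩ := by
  rw [Q.mkRho_eq z hz, LinearEquiv.symm_apply_apply]

theorem mkRho_surjective : Function.Surjective Q.mkRho := by
  rintro ⟨b, f⟩
  obtain ⟨z, hz⟩ := Q.isOpenQuotientMap_proj.surjective b
  exact ⟨_, Q.mkRho_rhoEquiv z hz f⟩

theorem mkRho_smul (t : Q.K) (z : Q.Z) (v : Fin m → ℂ) :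
    Q.mkRho (t • z, rot t v) = Q.mkRho (z, v) := by
  rw [Q.mkRho_eq (t • z) (Q.proj_smul t z), Q.mkRho_eq z rfl]
  congr 1
  rw [LinearEquiv.symm_apply_eq, Q.rhoEquiv_smul z (t • z) rfl _ t rfl,
    LinearEquiv.apply_symm_apply]

/-- The total space is the set of orbits of the diagonal action of `K` on `Z_P × ℂᵐ`. -/
theorem mkRho_eq_iff {z z' : Q.Z} {v v' : Fin m → ℂ} :
    Q.mkRho (z', v') = Q.mkRho (z, v) ↔ ∃ t : Q.K, t • z = z' ∧ rot t v = v' := by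
  constructor
  · intro h
    have hb : Q.proj z' = Q.proj z := congrArg TotalSpace.proj h
    obtain ⟨t, rfl⟩ := Q.proj_eq_iff.1 hb
    refine ⟨t, rfl, ?_⟩
    rw [← Q.mkRho_smul t z v, Q.mkRho_eq (t • z) rfl, Q.mkRho_eq (t • z) rfl] at h
    exact ((Q.rhoEquiv (t • z) rfl).symm.injective (TotalSpace.mk_injective _ h)).symm
  · rintro ⟨t, rfl, rfl⟩
    exact Q.mkRho_smul t z v

/-- The total space `Z_P ×_K ℂᵐ` carries the quotient topology. -/
instance : TopologicalSpace (TotalSpace (Fin m → ℂ) Q.Rho) :=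
  TopologicalSpace.coinduced Q.mkRho inferInstance

theorem isOpenQuotientMap_mkRho : IsOpenQuotientMap Q.mkRho := by
  refine ⟨Q.mkRho_surjective, continuous_coinduced_rng, fun O hO => ?_⟩
  rw [isOpen_coinduced]
  have h : Q.mkRho ⁻¹' (Q.mkRho '' O) =
      ⋃ t : Q.K, (fun x : Q.Z × (Fin m → ℂ) => (t • x.1, rot t x.2)) ⁻¹' O := by
    ext ⟨z, v⟩
    simp only [Set.mem_preimage, Set.mem_image, Set.mem_iUnion, Prod.exists]
    constructor
    · rintro ⟨z', v', hO', h⟩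
      obtain ⟨t, rfl, rfl⟩ := Q.mkRho_eq_iff.1 h
      exact ⟨t, hO'⟩
    · rintro ⟨t, ht⟩
      exact ⟨_, _, ht, Q.mkRho_smul t z v⟩
  rw [h]
  refine isOpen_iUnion fun t => hO.preimage ?_
  exact (continuous_fst.const_smul t).prodMk (continuous_rot.comp (continuous_const.prodMk
    continuous_snd))

theorem continuous_rhoEquiv_symm {b : Q.M} (z : Q.Z) (hz : Q.proj z = b) :
    Continuous (Q.rhoEquiv z hz).symm := by
  refine Continuous.subtype_mk (f := fun v => ((Q.rhoEquiv z hz).symm v).1) ?_ _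
  refine continuous_pi fun z' => ?_
  obtain ⟨t, ht⟩ := Q.proj_eq_iff.1 (z'.2.trans hz.symm)
  have : (fun v => ((Q.rhoEquiv z hz).symm v).1 z') = fun v => rot t v := by
    funext v
    have h := Q.rhoEquiv_smul z z'.1 hz z'.2 t ht ((Q.rhoEquiv z hz).symm v)
    rw [LinearEquiv.apply_symm_apply] at h
    exact h
  rw [this]
  exact continuous_rot.comp (continuous_const.prodMk continuous_id)

theorem continuous_rhoEquiv {b : Q.M} (z : Q.Z) (hz : Q.proj z = b) :
    Continuous (Q.rhoEquiv z hz) :=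
  (continuous_apply (⟨z, hz⟩ : {z : Q.Z // Q.proj z = b})).comp continuous_subtype_val

/-- A slice: a `K`-invariant open set `V` with an equivariant map `k : V → K`. -/
structure Slice where
  k : Q.Z → Q.K
  V : Set Q.Z
  isOpen : IsOpen V
  continuousOn : ContinuousOn k V
  smul_mem : ∀ z ∈ V, ∀ t : Q.K, t • z ∈ V
  map_smul : ∀ z ∈ V, ∀ t : Q.K, k (t • z) = k z * t⁻¹

variable {Q}

namespace Slice

variable (s : Q.Slice)

/-- A chosen point of the orbit over `b`. -/
def pt (b : Q.M) : Q.Z := (Q.isOpenQuotientMap_proj.surjective b).choose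

theorem proj_pt (b : Q.M) : Q.proj (pt b) = b :=
  (Q.isOpenQuotientMap_proj.surjective b).choose_spec

/-- The open subset of `M` over which the slice is defined. -/
def base : Set Q.M := Q.proj '' s.V

theorem isOpen_base : IsOpen s.base := Q.isOpenQuotientMap_proj.isOpenMap _ s.isOpen

theorem mem_V_of_proj {z : Q.Z} (h : Q.proj z ∈ s.base) : z ∈ s.V := by
  obtain ⟨z', hz', h'⟩ := h
  obtain ⟨t, rfl⟩ := Q.proj_eq_iff.1 h'.symm
  exact s.smul_mem z' hz' t

/-- The linear trivialization `[z, v] ↦ k(z) v` of the fibre over `b`. -/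
def lin (b : Q.M) (f : Q.Rho b) : Fin m → ℂ := rot (s.k (pt b)) (Q.rhoEquiv (pt b) (proj_pt b) f)

theorem lin_eq {b : Q.M} (hb : b ∈ s.base) (z : Q.Z) (hz : Q.proj z = b) (f : Q.Rho b) :
    s.lin b f = rot (s.k z) (Q.rhoEquiv z hz f) := by
  obtain ⟨t, ht⟩ := Q.proj_eq_iff.1 (hz.trans (proj_pt b).symm)
  have hV : pt b ∈ s.V := s.mem_V_of_proj (by rwa [proj_pt])
  rw [Q.rhoEquiv_smul (pt b) z (proj_pt b) hz t ht, ← ht, s.map_smul _ hV t,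
    Subgroup.coe_mul, Subgroup.coe_inv, rot_mul, rot_inv_rot, lin]

/-- The inverse of `lin`. -/
def linInv (b : Q.M) (v : Fin m → ℂ) : Q.Rho b :=
  (Q.rhoEquiv (pt b) (proj_pt b)).symm (rot (s.k (pt b))⁻¹ v)

theorem lin_linInv (b : Q.M) (v : Fin m → ℂ) : s.lin b (s.linInv b v) = v := by
  simp [lin, linInv]

theorem linInv_lin (b : Q.M) (f : Q.Rho b) : s.linInv b (s.lin b f) = f := by
  simp [lin, linInv]

theorem linInv_eq {b : Q.M} (hb : b ∈ s.base) (z : Q.Z) (hz : Q.proj z = b) (v : Fin m → ℂ) :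
    s.linInv b v = (Q.rhoEquiv z hz).symm (rot (s.k z)⁻¹ v) := by
  rw [LinearEquiv.eq_symm_apply]
  have h := s.lin_eq hb z hz (s.linInv b v)
  rw [lin_linInv] at h
  nth_rewrite 2 [h]
  simp

theorem continuousAt_k {X : Type*} [TopologicalSpace X] {g : X → Q.Z} {x : X}
    (hg : ContinuousAt g x) (hx : g x ∈ s.V) :
    ContinuousAt (fun y => ((s.k (g y) : Q.K) : Fin m → Circle)) x :=
  continuous_subtype_val.continuousAt.comp
    (ContinuousAt.comp (f := g) (s.continuousOn.continuousAt (s.isOpen.mem_nhds hx)) hg)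

theorem continuousAt_toFun {x : TotalSpace (Fin m → ℂ) Q.Rho} (hx : x.1 ∈ s.base) :
    ContinuousAt (fun x : TotalSpace (Fin m → ℂ) Q.Rho => (x.1, s.lin x.1 x.2)) x := by
  obtain ⟨⟨z, v⟩, rfl⟩ := Q.mkRho_surjective x
  have hz : z ∈ s.V := s.mem_V_of_proj hx
  rw [← Q.isOpenQuotientMap_mkRho.continuousAt_comp_iff]
  have h1 : ContinuousAt (fun y : Q.Z × (Fin m → ℂ) => (Q.proj y.1, rot (s.k y.1) y.2)) (z, v) :=
    (Q.isOpenQuotientMap_proj.continuous.comp continuous_fst).continuousAt.prodMk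
      (continuousAt_rot (s.continuousAt_k continuousAt_fst hz) continuousAt_snd)
  refine h1.congr ?_
  filter_upwards [(s.isOpen.preimage continuous_fst).mem_nhds hz] with y hy
  have hb : Q.proj y.1 ∈ s.base := ⟨_, hy, rfl⟩
  change _ = (Q.proj y.1, s.lin (Q.proj y.1) ((Q.rhoEquiv y.1 rfl).symm y.2))
  rw [s.lin_eq hb y.1 rfl, LinearEquiv.apply_symm_apply]

theorem continuousAt_invFun {y : Q.M × (Fin m → ℂ)} (hy : y.1 ∈ s.base) :
    ContinuousAt (fun y : Q.M × (Fin m → ℂ) =>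
      (⟨y.1, s.linInv y.1 y.2⟩ : TotalSpace (Fin m → ℂ) Q.Rho)) y := by
  obtain ⟨b, v⟩ := y
  obtain ⟨z, rfl⟩ := Q.isOpenQuotientMap_proj.surjective b
  have hz : z ∈ s.V := s.mem_V_of_proj hy
  have hq : IsOpenQuotientMap (Prod.map Q.proj (id : (Fin m → ℂ) → (Fin m → ℂ))) :=
    Q.isOpenQuotientMap_proj.prodMap IsOpenQuotientMap.id
  change ContinuousAt _ (Prod.map Q.proj (id : (Fin m → ℂ) → (Fin m → ℂ)) (z, v))
  rw [← hq.continuousAt_comp_iff]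
  have h1 : ContinuousAt (fun y : Q.Z × (Fin m → ℂ) => Q.mkRho (y.1, rot (s.k y.1)⁻¹ y.2))
      (z, v) :=
    ContinuousAt.comp (f := fun y : Q.Z × (Fin m → ℂ) =>
        (y.1, rot ((s.k y.1 : Fin m → Circle))⁻¹ y.2))
      Q.isOpenQuotientMap_mkRho.continuous.continuousAt
      (continuousAt_fst.prodMk
        (continuousAt_rot (s.continuousAt_k continuousAt_fst hz).inv continuousAt_snd))
  refine h1.congr ?_
  filter_upwards [(s.isOpen.preimage continuous_fst).mem_nhds hz] with y hy
  have hb : Q.proj y.1 ∈ s.base := ⟨_, hy, rfl⟩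
  change _ = (⟨Q.proj y.1, s.linInv (Q.proj y.1) y.2⟩ : TotalSpace (Fin m → ℂ) Q.Rho)
  rw [s.linInv_eq hb y.1 rfl]
  rfl

/-- The local trivialization of `Z_P ×_K ℂᵐ` defined by a slice. -/
def triv : Trivialization (Fin m → ℂ) (π (Fin m → ℂ) Q.Rho) where
  toFun x := (x.1, s.lin x.1 x.2)
  invFun y := ⟨y.1, s.linInv y.1 y.2⟩
  source := π (Fin m → ℂ) Q.Rho ⁻¹' s.base
  target := s.base ×ˢ Set.univ
  map_source' x hx := ⟨hx, trivial⟩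
  map_target' y hy := hy.1
  left_inv' x _ := by simp [linInv_lin]
  right_inv' y _ := by simp [lin_linInv]
  open_source := by
    have h : Continuous (π (Fin m → ℂ) Q.Rho) := by
      rw [Q.isOpenQuotientMap_mkRho.isQuotientMap.continuous_iff]
      exact Q.isOpenQuotientMap_proj.continuous.comp continuous_fst
    exact s.isOpen_base.preimage h
  open_target := s.isOpen_base.prod isOpen_univ
  continuousOn_toFun _ hx := (s.continuousAt_toFun hx).continuousWithinAt
  continuousOn_invFun _ hy := (s.continuousAt_invFun hy.1).continuousWithinAt
  baseSet := s.base
  open_baseSet := s.isOpen_base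
  source_eq := rfl
  target_eq := rfl
  proj_toFun _ _ := rfl

instance : s.triv.IsLinear ℂ where
  linear b _ := {
    map_add := fun f g => by
      change s.lin b (f + g) = s.lin b f + s.lin b g
      simp [lin, rot_add]
    map_smul := fun c f => by
      change s.lin b (c • f) = c • s.lin b f
      simp [lin, rot_smul] }

theorem coordChange_apply (s s' : Q.Slice) {z : Q.Z} (h : Q.proj z ∈ s.base)
    (h' : Q.proj z ∈ s'.base) (v : Fin m → ℂ) :
    s.triv.coordChangeL ℂ s'.triv (Q.proj z) v = rot (s'.k z * (s.k z)⁻¹) v := by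
  rw [Trivialization.coordChangeL_apply' _ _ ⟨h, h'⟩]
  change s'.lin (Q.proj z) (s.linInv (Q.proj z) v) = _
  rw [s'.lin_eq h' z rfl, s.linInv_eq h z rfl, LinearEquiv.apply_symm_apply, ← rot_mul]
  rfl

theorem exists_mem_base (b : Q.M) : ∃ s : Q.Slice, b ∈ s.base := by
  obtain ⟨z, rfl⟩ := Q.isOpenQuotientMap_proj.surjective b
  obtain ⟨k, V, hV, hz, hk, h⟩ := Q.exists_slice z
  exact ⟨⟨k, V, hV, hk, fun z hz t => (h z hz t).1, fun z hz t => (h z hz t).2⟩, z, hz, rfl⟩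

end Slice

instance : FiberBundle (Fin m → ℂ) Q.Rho where
  totalSpaceMk_isInducing' b := by
    obtain ⟨s, hs⟩ := Slice.exists_mem_base b
    have hp := Slice.proj_pt b
    have h1 : Continuous (TotalSpace.mk (F := Fin m → ℂ) (E := Q.Rho) b) := by
      have : TotalSpace.mk (F := Fin m → ℂ) (E := Q.Rho) b =
          fun f => Q.mkRho (Slice.pt b, Q.rhoEquiv (Slice.pt b) hp f) := by
        funext f
        rw [Q.mkRho_rhoEquiv]
      rw [this]
      exact Q.isOpenQuotientMap_mkRho.continuous.comp
        (continuous_const.prodMk (Q.continuous_rhoEquiv _ _))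
    rw [isInducing_iff_nhds]
    intro f
    refine le_antisymm h1.continuousAt.tendsto.le_comap ?_
    have h2 : ContinuousAt s.triv ⟨b, f⟩ := s.triv.continuousAt hs
    have h3 : ContinuousAt (fun y : Q.M × (Fin m → ℂ) => s.linInv b y.2) (b, s.lin b f) := by
      refine Continuous.continuousAt ?_
      refine (Q.continuous_rhoEquiv_symm _ hp).comp (continuous_rot.comp
        (continuous_const.prodMk continuous_snd))
    have h4 := h3.tendsto.comp (h2.tendsto.comp
      (Filter.tendsto_comap (f := TotalSpace.mk (F := Fin m → ℂ) (E := Q.Rho) b)))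
    have h5 : ((fun y : Q.M × (Fin m → ℂ) => s.linInv b y.2) ∘ s.triv ∘
        TotalSpace.mk (F := Fin m → ℂ) (E := Q.Rho) b) = id := by
      funext g
      exact s.linInv_lin b g
    rw [h5] at h4
    rw [s.linInv_lin b f] at h4
    exact h4
  trivializationAtlas' := Set.range Slice.triv
  trivializationAt' b := (Slice.exists_mem_base b).choose.triv
  mem_baseSet_trivializationAt' b := (Slice.exists_mem_base b).choose_spec
  trivialization_mem_atlas' b := ⟨_, rfl⟩

instance : VectorBundle ℂ (Fin m → ℂ) Q.Rho where
  trivialization_linear' := by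
    rintro _ ⟨s, rfl⟩
    infer_instance
  continuousOn_coordChange' := by
    rintro _ _ ⟨s, rfl⟩ ⟨s', rfl⟩
    rintro b ⟨hb, hb'⟩
    obtain ⟨z, rfl⟩ := Q.isOpenQuotientMap_proj.surjective b
    refine ContinuousAt.continuousWithinAt ?_
    rw [← Q.isOpenQuotientMap_proj.continuousAt_comp_iff, continuousAt_clm_apply]
    intro v
    have hz : z ∈ s.V := s.mem_V_of_proj hb
    have hz' : z ∈ s'.V := s'.mem_V_of_proj hb'
    have h1 : ContinuousAt (fun y : Q.Z => rot (s'.k y * (s.k y)⁻¹ : Fin m → Circle) v) z := by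
      exact continuousAt_rot ((s'.continuousAt_k continuousAt_id hz').mul
        (s.continuousAt_k continuousAt_id hz).inv) continuousAt_const
    refine h1.congr ?_
    filter_upwards [s.isOpen.mem_nhds hz, s'.isOpen.mem_nhds hz'] with y hy hy'
    exact (Slice.coordChange_apply s s' ⟨_, hy, rfl⟩ ⟨_, hy', rfl⟩ v).symm

end QuasitoricPair

end Bundles

/-! ### The tangent bundle of `M(P, Λ)` and its canonical stably complex structure -/

section Stable

open Bundle Topology

/-- A stably complex structure on a family of real vector spaces `T` over `B` (in the application
the tangent bundle of a manifold): an isomorphism of real vector bundles from `T ⊕ W`, where `W` is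
a trivial bundle, to a complex vector bundle `E`. -/
structure StablyComplexStructure {B : Type*} [TopologicalSpace B]
    (FT : Type*) (T : B → Type*) [∀ b, AddCommGroup (T b)] [∀ b, Module ℝ (T b)]
    [TopologicalSpace (TotalSpace FT T)]
    (W : Type*) [AddCommGroup W] [Module ℝ W] [TopologicalSpace W]
    (F : Type*) (E : B → Type*) [TopologicalSpace (TotalSpace F E)]
    [∀ b, AddCommGroup (E b)] [∀ b, Module ℝ (E b)] where
  equiv : ∀ b, (T b × W) ≃ₗ[ℝ] E b
  continuous_equiv : Continuous fun x : TotalSpace FT T × W =>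
    (⟨x.1.1, equiv x.1.1 (x.1.2, x.2)⟩ : TotalSpace F E)
  continuous_symm : Continuous fun y : TotalSpace F E =>
    ((⟨⟨y.1, ((equiv y.1).symm y.2).1⟩, ((equiv y.1).symm y.2).2⟩ : TotalSpace FT T × W))

/-- The first Chern class of a stably complex structure `T ⊕ W ≅ E` is that of the complex vector
bundle `E`. -/
def StablyComplexStructure.firstChernClass {B : Type*} [TopologicalSpace B]
    [T2Space B] [ParacompactSpace B]
    {FT : Type*} {T : B → Type*} [∀ b, AddCommGroup (T b)] [∀ b, Module ℝ (T b)]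
    [TopologicalSpace (TotalSpace FT T)]
    {W : Type*} [AddCommGroup W] [Module ℝ W] [TopologicalSpace W]
    {F : Type*} [NormedAddCommGroup F] [NormedSpace ℂ F] [FiniteDimensional ℂ F]
    {E : B → Type*} [TopologicalSpace (TotalSpace F E)]
    [∀ b, AddCommGroup (E b)] [∀ b, Module ℝ (E b)] [∀ b, Module ℂ (E b)]
    [∀ b, IsScalarTower ℝ ℂ (E b)] [∀ b, TopologicalSpace (E b)] [FiberBundle F E]
    [VectorBundle ℂ F E] (_c : StablyComplexStructure FT T W F E) : CechH B ℤ 2 :=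
  _root_.firstChernClass F E

/-- The standard real inner product on `ℂᵐ`. -/
def realInner {m : ℕ} : (Fin m → ℂ) →ₗ[ℝ] (Fin m → ℂ) →ₗ[ℝ] ℝ :=
  LinearMap.mk₂ ℝ (fun v w => ∑ j, ((v j).re * (w j).re + (v j).im * (w j).im))
    (fun v v' w => by
      simp only [Pi.add_apply, Complex.add_re, Complex.add_im, ← Finset.sum_add_distrib]
      exact Finset.sum_congr rfl fun j _ => by ring)
    (fun c v w => by
      simp only [Pi.smul_apply, Complex.real_smul, Complex.re_ofReal_mul, Complex.im_ofReal_mul,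
        smul_eq_mul, Finset.mul_sum]
      exact Finset.sum_congr rfl fun j _ => by ring)
    (fun v w w' => by
      simp only [Pi.add_apply, Complex.add_re, Complex.add_im, ← Finset.sum_add_distrib]
      exact Finset.sum_congr rfl fun j _ => by ring)
    (fun c v w => by
      simp only [Pi.smul_apply, Complex.real_smul, Complex.re_ofReal_mul, Complex.im_ofReal_mul,
        smul_eq_mul, Finset.mul_sum]
      exact Finset.sum_congr rfl fun j _ => by ring)

theorem realInner_apply {m : ℕ} (v w : Fin m → ℂ) :
    realInner v w = ∑ j, ((v j).re * (w j).re + (v j).im * (w j).im) := rfl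

theorem realInner_rot {m : ℕ} (t : Fin m → Circle) (v w : Fin m → ℂ) :
    realInner (rot t v) (rot t w) = realInner v w := by
  rw [realInner_apply, realInner_apply]
  refine Finset.sum_congr rfl fun j _ => ?_
  have h : (t j : ℂ).re * (t j : ℂ).re + (t j : ℂ).im * (t j : ℂ).im = 1 := by
    have := Circle.normSq_coe (t j)
    rwa [Complex.normSq_apply] at this
  simp only [rot_apply, Complex.mul_re, Complex.mul_im]
  linear_combination ((v j).re * (w j).re + (v j).im * (w j).im) * h

theorem realInner_self_eq_zero {m : ℕ} {v : Fin m → ℂ} (h : realInner v v = 0) : v = 0 := by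
  rw [realInner_apply, Finset.sum_eq_zero_iff_of_nonneg fun j _ => by
    nlinarith [mul_self_nonneg (v j).re, mul_self_nonneg (v j).im]] at h
  funext j
  have := h j (Finset.mem_univ j)
  rw [← Complex.normSq_apply, Complex.normSq_eq_zero] at this
  exact this

theorem realInner_comm {m : ℕ} (v w : Fin m → ℂ) : realInner v w = realInner w v := by
  simp only [realInner_apply]
  exact Finset.sum_congr rfl fun j _ => by ring

theorem continuous_realInner {m : ℕ} : Continuous fun x : (Fin m → ℂ) × (Fin m → ℂ) =>
    realInner x.1 x.2 := by
  simp only [realInner_apply]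
  fun_prop

/-- Orthogonal projection to a continuously varying subspace of `ℂᵐ` is continuous. -/
theorem exists_orthogonal_component {m : ℕ} {X : Type*} [TopologicalSpace X] {W : Type*}
    [NormedAddCommGroup W] [NormedSpace ℝ W] [FiniteDimensional ℝ W]
    (Φ : X → W →ₗ[ℝ] (Fin m → ℂ)) (hc : ∀ w, Continuous fun x => Φ x w)
    (hi : ∀ x, Function.Injective (Φ x)) :
    ∃ c : X → (Fin m → ℂ) →ₗ[ℝ] W, (Continuous fun y : X × (Fin m → ℂ) => c y.1 y.2) ∧
      ∀ x v w, realInner (Φ x w) (v - Φ x (c x v)) = 0 := by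
  let D : X → (Fin m → ℂ) →ₗ[ℝ] (W →L[ℝ] ℝ) := fun x =>
    { toFun := fun v => LinearMap.toContinuousLinearMap ((realInner v).comp (Φ x))
      map_add' := fun v v' => by ext w; simp
      map_smul' := fun c v => by ext w; simp }
  have hD : ∀ x v w, D x v w = realInner v (Φ x w) := fun x v w => rfl
  have hDc : Continuous fun y : X × (Fin m → ℂ) => D y.1 y.2 := by
    rw [continuous_clm_apply]
    intro w
    simp only [hD]
    exact continuous_realInner.comp (continuous_snd.prodMk ((hc w).comp continuous_fst))
  let G : X → W →L[ℝ] (W →L[ℝ] ℝ) := fun x => LinearMap.toContinuousLinearMap ((D x).comp (Φ x))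
  have hG : ∀ x w, G x w = D x (Φ x w) := fun x w => rfl
  have hGc : Continuous G := by
    rw [continuous_clm_apply]
    intro w
    exact hDc.comp (continuous_id.prodMk (hc w))
  have hGi : ∀ x, Function.Injective (G x) := by
    intro x
    rw [injective_iff_map_eq_zero]
    intro w hw
    have h1 : realInner (Φ x w) (Φ x w) = 0 := by
      rw [← hD, ← hG, hw]; rfl
    exact hi x ((realInner_self_eq_zero h1).trans (map_zero _).symm)
  have hGe : ∀ x, (G x).IsInvertible := by
    intro x
    have hd : Module.finrank ℝ W = Module.finrank ℝ (W →L[ℝ] ℝ) := by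
      rw [← (LinearMap.toContinuousLinearMap (𝕜 := ℝ) (E := W) (F' := ℝ)).finrank_eq]
      exact (Subspace.dual_finrank_eq (K := ℝ) (V := W)).symm
    let e : W ≃ₗ[ℝ] (W →L[ℝ] ℝ) :=
      LinearEquiv.ofInjectiveOfFinrankEq (G x : W →ₗ[ℝ] _) (hGi x) hd
    refine ⟨e.toContinuousLinearEquiv, ?_⟩
    ext1 w
    rfl
  have hinv : Continuous fun x : X => (G x).inverse := by
    rw [continuous_iff_continuousAt]
    intro x
    exact ContinuousAt.comp (f := G)
      ((hGe x).contDiffAt_map_inverse (n := 0)).continuousAt hGc.continuousAt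
  refine ⟨fun x => ((G x).inverse : _ →ₗ[ℝ] W).comp (D x), ?_, fun x v w => ?_⟩
  · exact (hinv.comp continuous_fst).clm_apply hDc
  · have h0 : G x ((G x).inverse (D x v)) = D x v := (hGe x).self_apply_inverse _
    have h := congrArg (fun g => g w) h0
    simp only [hG, hD] at h
    rw [realInner_comm, map_sub, LinearMap.sub_apply]
    exact sub_eq_zero.2 h.symm

namespace QuasitoricPair

variable {n m : ℕ} (Q : QuasitoricPair n m)

/-- The Lie algebra of `K(Λ)`: the kernel of `Λ : ℝᵐ → ℝⁿ`. -/
def lieK : Submodule ℝ (Fin m → ℝ) :=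
  LinearMap.ker (Matrix.mulVecLin (Q.Λ.map (fun k : ℤ => (k : ℝ))))

/-- The linear relations `∑ bⱼ aⱼ = 0` between the normals, i.e. the orthogonal complement of the
image of `A_P : ℝⁿ → ℝᵐ`. -/
def relations : Submodule ℝ (Fin m → ℝ) := LinearMap.ker (Fintype.linearCombination ℝ Q.normal)

/-- The tangent space of `Z_P ⊆ ℂᵐ` at `z`: vectors `v` for which `dμ(v) = (2 Re (z̄ⱼ vⱼ))ⱼ` is the
image `A_P u` of some `u ∈ ℝⁿ`. -/
def tangentZ (z : Q.Z) : Submodule ℝ (Fin m → ℂ) where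
  carrier := {v | ∃ u, ∀ j, 2 * ((starRingEnd ℂ (Q.coord z j)) * v j).re = ⟪Q.normal j, u⟫}
  zero_mem' := ⟨0, fun j => by simp⟩
  add_mem' := by
    rintro v w ⟨u, hu⟩ ⟨u', hu'⟩
    refine ⟨u + u', fun j => ?_⟩
    rw [inner_add_right, ← hu, ← hu', Pi.add_apply, mul_add, Complex.add_re, mul_add]
  smul_mem' := by
    rintro c v ⟨u, hu⟩
    refine ⟨c • u, fun j => ?_⟩
    rw [inner_smul_right, ← hu, Pi.smul_apply, Complex.real_smul, mul_left_comm,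
      Complex.re_ofReal_mul]
    ring

/-- The tangent space at `z` to the orbit `K z`. -/
def tangentOrbit (z : Q.Z) : Submodule ℝ (Fin m → ℂ) where
  carrier := {v | ∃ θ ∈ Q.lieK, ∀ j, v j = (θ j : ℂ) * Complex.I * Q.coord z j}
  zero_mem' := ⟨0, zero_mem _, fun j => by simp⟩
  add_mem' := by
    rintro v w ⟨θ, hθ, h⟩ ⟨θ', hθ', h'⟩
    refine ⟨θ + θ', add_mem hθ hθ', fun j => ?_⟩
    rw [Pi.add_apply, h, h', Pi.add_apply, Complex.ofReal_add]; ring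
  smul_mem' := by
    rintro c v ⟨θ, hθ, h⟩
    refine ⟨c • θ, Submodule.smul_mem _ c hθ, fun j => ?_⟩
    rw [Pi.smul_apply, h, Pi.smul_apply, smul_eq_mul, Complex.ofReal_mul, Complex.real_smul]; ring

/-- The horizontal space at `z`: the tangent vectors of `Z_P` orthogonal to the orbit `K z`. The
differential of `Z_P → M` maps it isomorphically to the tangent space of `M = Z_P / K`. -/
def horizontal (z : Q.Z) : Submodule ℝ (Fin m → ℂ) where
  carrier := {v | v ∈ Q.tangentZ z ∧ ∀ w ∈ Q.tangentOrbit z, realInner w v = 0}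
  zero_mem' := ⟨zero_mem _, fun w _ => map_zero _⟩
  add_mem' := fun {v w} hv hw => ⟨add_mem hv.1 hw.1, fun x hx => by
    rw [map_add, hv.2 x hx, hw.2 x hx, add_zero]⟩
  smul_mem' := fun c v hv => ⟨Submodule.smul_mem _ c hv.1, fun x hx => by
    rw [map_smul, hv.2 x hx, smul_zero]⟩

/-- The tangent bundle `τ(M) = (τ(Z_P) / ξ) / K`, where `ξ` is the bundle of tangents along the
orbits of `K`; here `τ(Z_P) / ξ` is identified with the horizontal bundle. It is a subbundle of
`(Z_P × ℂᵐ) / K = Z_P ×_K ℂᵐ`. -/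
def tauSubmodule (b : Q.M) : Submodule ℝ (Q.Rho b) where
  carrier := {f | ∀ z hz, Q.rhoEquiv z hz f ∈ Q.horizontal z}
  zero_mem' := fun z hz => by rw [map_zero]; exact zero_mem _
  add_mem' := fun {f g} hf hg z hz => by rw [map_add]; exact add_mem (hf z hz) (hg z hz)
  smul_mem' := fun c f hf z hz => Submodule.smul_mem _ c (hf z hz)

/-- The tangent bundle of `M`. -/
def Tau (b : Q.M) : Type := Q.tauSubmodule b

instance (b : Q.M) : AddCommGroup (Q.Tau b) := inferInstanceAs (AddCommGroup (Q.tauSubmodule b))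
instance (b : Q.M) : Module ℝ (Q.Tau b) := inferInstanceAs (Module ℝ (Q.tauSubmodule b))

/-- The inclusion of total spaces `τ(M) ⊆ Z_P ×_K ℂᵐ`. -/
def tauIncl (x : TotalSpace (Fin n → ℂ) Q.Tau) : TotalSpace (Fin m → ℂ) Q.Rho := ⟨x.1, x.2.1⟩

instance : TopologicalSpace (TotalSpace (Fin n → ℂ) Q.Tau) :=
  TopologicalSpace.induced Q.tauIncl inferInstance

/-- The trivial summand: `ξ / K` and `ν(i_Z) / K` are trivial bundles, with fibres the Lie algebra
of `K` and the space of relations between the normals. -/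
abbrev Framing : Type := Q.lieK × Q.relations

/-- The framing of `ξ ⊕ ν(i_Z)`: `(θ, b) ↦ ((bⱼ + iθⱼ) zⱼ)ⱼ`. -/
def framing (z : Q.Z) : Q.Framing →ₗ[ℝ] (Fin m → ℂ) where
  toFun w := fun j => ((w.2.1 j : ℂ) + (w.1.1 j : ℂ) * Complex.I) * Q.coord z j
  map_add' w w' := by
    funext j
    simp
    ring
  map_smul' c w := by
    funext j
    simp
    ring

theorem framing_apply (z : Q.Z) (w : Q.Framing) (j : Fin m) :
    Q.framing z w j = ((w.2.1 j : ℂ) + (w.1.1 j : ℂ) * Complex.I) * Q.coord z j := rfl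

theorem framing_smul (t : Q.K) (z : Q.Z) (w : Q.Framing) :
    Q.framing (t • z) w = rot t (Q.framing z w) := by
  funext j
  rw [framing_apply, rot_apply, framing_apply, show Q.coord (t • z) j = t.1 j * Q.coord z j from rfl]
  ring

theorem continuous_framing (w : Q.Framing) : Continuous fun z => Q.framing z w :=
  continuous_pi fun j => continuous_const.mul ((continuous_apply j).comp Q.continuous_coord)

theorem continuous_framing' : Continuous fun x : Q.Z × Q.Framing => Q.framing x.1 x.2 := by
  refine continuous_pi fun j => ?_
  simp only [framing_apply]
  have h1 : Continuous fun x : Q.Z × Q.Framing => x.2.2.1 j :=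
    (continuous_apply j).comp (continuous_subtype_val.comp (continuous_snd.comp continuous_snd))
  have h2 : Continuous fun x : Q.Z × Q.Framing => x.2.1.1 j :=
    (continuous_apply j).comp (continuous_subtype_val.comp (continuous_fst.comp continuous_snd))
  have h3 : Continuous fun x : Q.Z × Q.Framing => Q.coord x.1 j :=
    (continuous_apply j).comp (Q.continuous_coord.comp continuous_fst)
  exact ((Complex.continuous_ofReal.comp h1).add
    ((Complex.continuous_ofReal.comp h2).mul continuous_const)).mul h3

theorem framing_injective (z : Q.Z) : Function.Injective (Q.framing z) := by
  rw [← LinearMap.ker_eq_bot, LinearMap.ker_eq_bot']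
  intro w hw
  obtain ⟨f, hfv, hfr, hli⟩ := Q.exists_vertex z.2.1
  have hfi : Function.Injective f := fun i i' h => hli.injective (by simp only [h])
  have h0 : ∀ j, j ∉ Set.range f → w.2.1 j = 0 ∧ w.1.1 j = 0 := by
    intro j hj
    have hz : Q.coord z j ≠ 0 := by
      intro h
      refine hj (hfr j ?_)
      rw [← z.2.2 j]
      have : z.1.2 j = 0 := h
      simp [this]
    have h1 := congrFun hw j
    rw [framing_apply, Pi.zero_apply] at h1
    have h2 := (mul_eq_zero.1 h1).resolve_right hz
    exact ⟨by simpa using congrArg Complex.re h2, by simpa using congrArg Complex.im h2⟩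
  have hb : ∀ i, w.2.1 (f i) = 0 := by
    have h1 : ∑ j, w.2.1 j • Q.normal j = 0 := w.2.2
    rw [← Fintype.sum_of_injective f hfi (fun i => w.2.1 (f i) • Q.normal (f i)) _
      (fun j hj => by rw [(h0 j hj).1, zero_smul]) (fun _ => rfl)] at h1
    exact Fintype.linearIndependent_iff.1 hli _ h1
  have hθ : (fun i => w.1.1 (f i)) = 0 := by
    have h1 : (Q.Λ.map (fun k : ℤ => (k : ℝ))).mulVec w.1.1 = 0 := w.1.2
    have h2 : ((Q.Λ.submatrix id f).map (fun k : ℤ => (k : ℝ))).mulVec (fun i => w.1.1 (f i)) = 0 := by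
      funext i
      have h3 := congrFun h1 i
      simp only [Matrix.mulVec, dotProduct, Matrix.map_apply] at h3 ⊢
      rw [← h3]
      exact Fintype.sum_of_injective f hfi _ _
        (fun j hj => by rw [(h0 j hj).2, mul_zero]) (fun _ => rfl)
    refine Matrix.eq_zero_of_mulVec_eq_zero ?_ h2
    have h4 : ((Q.Λ.submatrix id f).map (fun k : ℤ => (k : ℝ))).det
        = (((Q.Λ.submatrix id f).det : ℤ) : ℝ) := ((Int.castRingHom ℝ).map_det _).symm
    rw [h4]
    rcases Q.unimodular f hfv with h | h <;> rw [h] <;> simp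
  have hall : ∀ j, w.2.1 j = 0 ∧ w.1.1 j = 0 := by
    intro j
    by_cases hj : j ∈ Set.range f
    · obtain ⟨i, rfl⟩ := hj
      exact ⟨hb i, congrFun hθ i⟩
    · exact h0 j hj
  exact Prod.ext (Subtype.ext (funext fun j => (hall j).2))
    (Subtype.ext (funext fun j => (hall j).1))

/-- The horizontal space is the orthogonal complement of the image of the framing. -/
theorem mem_horizontal_iff (z : Q.Z) (v : Fin m → ℂ) :
    v ∈ Q.horizontal z ↔ ∀ w, realInner (Q.framing z w) v = 0 := by
  have e1 : ∀ b : Q.relations, realInner (Q.framing z (0, b)) v =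
      ∑ j, b.1 j * ((starRingEnd ℂ (Q.coord z j)) * v j).re := by
    intro b
    rw [realInner_apply]
    refine Finset.sum_congr rfl fun j _ => ?_
    simp [framing_apply]
    ring
  constructor
  · rintro ⟨⟨u, hu⟩, h⟩ w
    have hw : w = (w.1, 0) + (0, w.2) := by simp
    rw [hw, map_add, map_add, LinearMap.add_apply, h _ ⟨w.1, w.1.2, fun j => by simp [framing_apply]⟩,
      zero_add, e1]
    have h1 : ∑ j, w.2.1 j • Q.normal j = 0 := w.2.2
    have h2 : ⟪∑ j, w.2.1 j • Q.normal j, u⟫ = 0 := by rw [h1, inner_zero_left]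
    rw [sum_inner] at h2
    simp only [real_inner_smul_left, ← hu] at h2
    have h3 : ∑ j, w.2.1 j * (2 * ((starRingEnd ℂ (Q.coord z j)) * v j).re) =
        2 * ∑ j, w.2.1 j * ((starRingEnd ℂ (Q.coord z j)) * v j).re := by
      rw [Finset.mul_sum]; exact Finset.sum_congr rfl fun j _ => by ring
    linarith
  · intro h
    refine ⟨?_, ?_⟩
    · set A : EuclideanSpace ℝ (Fin n) →ₗ[ℝ] (Fin m → ℝ) :=
        LinearMap.pi fun j => (innerₛₗ ℝ (Q.normal j)) with hA
      set y : Fin m → ℝ := fun j => 2 * ((starRingEnd ℂ (Q.coord z j)) * v j).re with hy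
      have hyA : y ∈ LinearMap.range A := by
        rw [← Subspace.dualAnnihilator_dualCoannihilator_eq (W := LinearMap.range A),
          Submodule.mem_dualCoannihilator]
        intro φ hφ
        rw [Submodule.mem_dualAnnihilator] at hφ
        have hφe : ∀ x : Fin m → ℝ, φ x = ∑ j, φ (Pi.single j 1) * x j := by
          intro x
          conv_lhs => rw [← Finset.univ_sum_single x]
          rw [map_sum]
          refine Finset.sum_congr rfl fun j _ => ?_
          have : (Pi.single j (x j) : Fin m → ℝ) = x j • Pi.single j 1 := by
            rw [← Pi.single_smul, smul_eq_mul, mul_one]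
          rw [this, map_smul, smul_eq_mul, mul_comm]
        have hrel : ∑ j, φ (Pi.single j 1) • Q.normal j = 0 := by
          refine ext_inner_right ℝ fun u => ?_
          rw [sum_inner, inner_zero_left, ← hφ (A u) ⟨u, rfl⟩, hφe]
          refine Finset.sum_congr rfl fun j _ => ?_
          rw [real_inner_smul_left]; rfl
        have h1 := h (0, ⟨fun j => φ (Pi.single j 1), hrel⟩)
        rw [e1] at h1
        rw [hφe, hy]
        have h3 : ∑ j, φ (Pi.single j 1) * (2 * ((starRingEnd ℂ (Q.coord z j)) * v j).re) =
            2 * ∑ j, φ (Pi.single j 1) * ((starRingEnd ℂ (Q.coord z j)) * v j).re := by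
          rw [Finset.mul_sum]; exact Finset.sum_congr rfl fun j _ => by ring
        rw [h3, h1, mul_zero]
      obtain ⟨u, hu⟩ := hyA
      exact ⟨u, fun j => (congrFun hu j).symm⟩
    · rintro w ⟨θ, hθ, hw⟩
      have : w = Q.framing z (⟨θ, hθ⟩, 0) := by
        funext j
        rw [hw, framing_apply]
        simp
      rw [this]
      exact h _

/-- The component in `Framing` of a vector of `ℂᵐ`, with respect to orthogonal projection. -/
def comp (z : Q.Z) : (Fin m → ℂ) →ₗ[ℝ] Q.Framing :=
  (exists_orthogonal_component Q.framing Q.continuous_framing Q.framing_injective).choose z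

theorem continuous_comp : Continuous fun x : Q.Z × (Fin m → ℂ) => Q.comp x.1 x.2 :=
  (exists_orthogonal_component Q.framing Q.continuous_framing
    Q.framing_injective).choose_spec.1

theorem sub_comp_mem (z : Q.Z) (v : Fin m → ℂ) :
    v - Q.framing z (Q.comp z v) ∈ Q.horizontal z :=
  (Q.mem_horizontal_iff z _).2 ((exists_orthogonal_component Q.framing Q.continuous_framing
    Q.framing_injective).choose_spec.2 z v)

theorem comp_unique (z : Q.Z) {v : Fin m → ℂ} {w : Q.Framing}
    (h : v - Q.framing z w ∈ Q.horizontal z) : Q.comp z v = w := by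
  have h1 := sub_mem h (Q.sub_comp_mem z v)
  have h2 : v - Q.framing z w - (v - Q.framing z (Q.comp z v)) =
      Q.framing z (Q.comp z v - w) := by rw [map_sub]; abel
  rw [h2, mem_horizontal_iff] at h1
  have h3 := realInner_self_eq_zero (h1 (Q.comp z v - w))
  exact sub_eq_zero.1 (Q.framing_injective z (h3.trans (map_zero _).symm))

theorem horizontal_smul (t : Q.K) (z : Q.Z) {v : Fin m → ℂ} :
    rot t v ∈ Q.horizontal (t • z) ↔ v ∈ Q.horizontal z := by
  rw [mem_horizontal_iff, mem_horizontal_iff]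
  refine forall_congr' fun w => ?_
  rw [framing_smul, realInner_rot]

theorem rot_sub (t : Fin m → Circle) (v w : Fin m → ℂ) : rot t (v - w) = rot t v - rot t w := by
  funext j; simp [mul_sub]

theorem comp_smul (t : Q.K) (z : Q.Z) (v : Fin m → ℂ) :
    Q.comp (t • z) (rot t v) = Q.comp z v := by
  refine Q.comp_unique (t • z) ?_
  rw [framing_smul, ← rot_sub, horizontal_smul]
  exact Q.sub_comp_mem z v

/-- The framing as a section of `Z_P ×_K ℂᵐ`. -/
def framingRho (b : Q.M) : Q.Framing →ₗ[ℝ] Q.Rho b where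
  toFun w := ⟨fun z => Q.framing z.1 w, fun z z' t h => by
    change Q.framing z'.1 w = rot t (Q.framing z.1 w)
    rw [← h, framing_smul]⟩
  map_add' w w' := Subtype.ext (funext fun z => map_add (Q.framing z.1) w w')
  map_smul' c w := Subtype.ext (funext fun z => map_smul (Q.framing z.1) c w)

theorem rhoEquiv_framingRho {b : Q.M} (z : Q.Z) (hz : Q.proj z = b) (w : Q.Framing) :
    Q.rhoEquiv z hz (Q.framingRho b w) = Q.framing z w := rfl

/-- The isomorphism `τ(M) ⊕ (ξ / K) ⊕ (ν(i_Z) / K) ≅ Z_P ×_K ℂᵐ`, obtained by factoring out the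
isomorphism `τ(Z_P) ⊕ ν(i_Z) ≅ Z_P × ℂᵐ` by the action of `K`. -/
def tauEquiv (b : Q.M) : (Q.Tau b × Q.Framing) ≃ₗ[ℝ] Q.Rho b :=
  LinearEquiv.ofBijective
    (LinearMap.coprod (Q.tauSubmodule b).subtype (Q.framingRho b))
    (by
      obtain ⟨z, hz⟩ := Q.isOpenQuotientMap_proj.surjective b
      constructor
      · rw [← LinearMap.ker_eq_bot, LinearMap.ker_eq_bot']
        rintro ⟨f, w⟩ h
        have h0 : f.1 + Q.framingRho b w = 0 := h
        have h1 : Q.rhoEquiv z hz f.1 + Q.framing z w = 0 := by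
          rw [← Q.rhoEquiv_framingRho z hz, ← map_add, h0, map_zero]
        have h2 : (0 : Fin m → ℂ) - Q.framing z w ∈ Q.horizontal z := by
          rw [← h1, add_sub_cancel_right]
          exact f.2 z hz
        have h3 : w = 0 := by rw [← Q.comp_unique z h2, map_zero]
        subst h3
        rw [map_zero, add_zero] at h0
        exact Prod.ext (Subtype.ext h0) rfl
      · intro g
        set w := Q.comp z (Q.rhoEquiv z hz g) with hw
        refine ⟨(⟨g - Q.framingRho b w, fun z' hz' => ?_⟩, w), ?_⟩
        · obtain ⟨t, rfl⟩ := Q.proj_eq_iff.1 (hz'.trans hz.symm)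
          rw [Q.rhoEquiv_smul z _ hz hz' t rfl, horizontal_smul, map_sub, rhoEquiv_framingRho]
          exact Q.sub_comp_mem z _
        · change (g - Q.framingRho b w) + Q.framingRho b w = g
          exact sub_add_cancel _ _)

theorem tauEquiv_apply (b : Q.M) (x : Q.Tau b × Q.Framing) :
    Q.tauEquiv b x = x.1.1 + Q.framingRho b x.2 := rfl

theorem tauEquiv_symm_snd {b : Q.M} (z : Q.Z) (hz : Q.proj z = b) (g : Q.Rho b) :
    ((Q.tauEquiv b).symm g).2 = Q.comp z (Q.rhoEquiv z hz g) := by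
  symm
  refine Q.comp_unique z ?_
  have h := (Q.tauEquiv b).apply_symm_apply g
  rw [tauEquiv_apply] at h
  conv_rhs => rw [← Q.rhoEquiv_framingRho z hz]
  rw [← map_sub]
  have h1 : g - Q.framingRho b ((Q.tauEquiv b).symm g).2 = ((Q.tauEquiv b).symm g).1.1 :=
    sub_eq_of_eq_add h.symm
  rw [h1]
  exact ((Q.tauEquiv b).symm g).1.2 z hz

theorem tauEquiv_symm_fst {b : Q.M} (g : Q.Rho b) :
    ((Q.tauEquiv b).symm g).1.1 = g - Q.framingRho b ((Q.tauEquiv b).symm g).2 := by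
  have h := (Q.tauEquiv b).apply_symm_apply g
  rw [tauEquiv_apply] at h
  exact eq_sub_of_add_eq h

/-- The canonical stably complex structure `c_τ(P, Λ)` on `M(P, Λ)`:
`τ(M) ⊕ ℝ^{2(m-n)} ≅ ρ₁ ⊕ … ⊕ ρ_m`. -/
def cTau : StablyComplexStructure (Fin n → ℂ) Q.Tau Q.Framing (Fin m → ℂ) Q.Rho where
  equiv := Q.tauEquiv
  continuous_equiv := by
    have h : Continuous fun x : TotalSpace (Fin m → ℂ) Q.Rho × Q.Framing =>
        (⟨x.1.1, x.1.2 + Q.framingRho x.1.1 x.2⟩ : TotalSpace (Fin m → ℂ) Q.Rho) := by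
      have hq : IsOpenQuotientMap (Prod.map Q.mkRho (id : Q.Framing → Q.Framing)) :=
        Q.isOpenQuotientMap_mkRho.prodMap IsOpenQuotientMap.id
      rw [hq.isQuotientMap.continuous_iff]
      have h1 : Continuous fun y : (Q.Z × (Fin m → ℂ)) × Q.Framing =>
          Q.mkRho (y.1.1, y.1.2 + Q.framing y.1.1 y.2) := by
        refine Q.isOpenQuotientMap_mkRho.continuous.comp
          ((continuous_fst.comp continuous_fst).prodMk
            ((continuous_snd.comp continuous_fst).add (Q.continuous_framing'.comp
              ((continuous_fst.comp continuous_fst).prodMk continuous_snd))))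
      refine h1.congr fun y => ?_
      have h0 : (Q.rhoEquiv y.1.1 rfl).symm (Q.framing y.1.1 y.2) =
          Q.framingRho (Q.proj y.1.1) y.2 := by
        rw [LinearEquiv.symm_apply_eq]
        rfl
      rw [Q.mkRho_eq y.1.1 rfl, map_add, h0]
      rfl
    have hi : Continuous Q.tauIncl := continuous_induced_dom
    exact h.comp ((hi.comp continuous_fst).prodMk continuous_snd)
  continuous_symm := by
    have h2 : Continuous fun y : TotalSpace (Fin m → ℂ) Q.Rho => ((Q.tauEquiv y.1).symm y.2).2 := by
      rw [Q.isOpenQuotientMap_mkRho.isQuotientMap.continuous_iff]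
      refine Q.continuous_comp.congr fun y => ?_
      change _ = ((Q.tauEquiv (Q.proj y.1)).symm ((Q.rhoEquiv y.1 rfl).symm y.2)).2
      rw [Q.tauEquiv_symm_snd y.1 rfl, LinearEquiv.apply_symm_apply]
    refine Continuous.prodMk ?_ h2
    rw [continuous_induced_rng, Q.isOpenQuotientMap_mkRho.isQuotientMap.continuous_iff]
    have h1 : Continuous fun y : Q.Z × (Fin m → ℂ) =>
        Q.mkRho (y.1, y.2 - Q.framing y.1 (Q.comp y.1 y.2)) := by
      refine Q.isOpenQuotientMap_mkRho.continuous.comp (continuous_fst.prodMk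
        (continuous_snd.sub (Q.continuous_framing'.comp
          (continuous_fst.prodMk Q.continuous_comp))))
    refine h1.congr fun y => ?_
    change _ = (⟨Q.proj y.1, ((Q.tauEquiv (Q.proj y.1)).symm ((Q.rhoEquiv y.1 rfl).symm y.2)).1.1⟩ :
      TotalSpace (Fin m → ℂ) Q.Rho)
    rw [tauEquiv_symm_fst, Q.tauEquiv_symm_snd y.1 rfl, LinearEquiv.apply_symm_apply,
      Q.mkRho_eq y.1 rfl, map_sub]
    congr 2
    rw [LinearEquiv.symm_apply_eq]
    rfl

/-- The trivial summand has real dimension `2(m - n)`. -/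
theorem finrank_framing : Module.finrank ℝ Q.Framing = 2 * (m - n) := by
  have h1 : Module.finrank ℝ Q.lieK = m - n := by
    have h := LinearMap.finrank_range_add_finrank_ker
      (Matrix.mulVecLin (Q.Λ.map (fun k : ℤ => (k : ℝ))))
    have hs : LinearMap.range (Matrix.mulVecLin (Q.Λ.map (fun k : ℤ => (k : ℝ)))) = ⊤ := by
      rw [LinearMap.range_eq_top]
      intro y
      refine ⟨∑ i, Pi.single (Fin.castLE Q.le i) (y i), ?_⟩
      funext i
      rw [map_sum, Finset.sum_apply, Finset.sum_eq_single i]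
      · have := congrFun (congrFun Q.refined i) i
        rw [Matrix.submatrix_apply, id, Matrix.one_apply_eq] at this
        simp [this]
      · intro i' _ hi'
        have := congrFun (congrFun Q.refined i) i'
        rw [Matrix.submatrix_apply, id, Matrix.one_apply_ne hi'.symm] at this
        simp [this]
      · simp
    rw [hs, finrank_top] at h
    simp only [Module.finrank_fin_fun] at h
    exact Nat.eq_sub_of_add_eq' h
  have h2 : Module.finrank ℝ Q.relations = m - n := by
    have h := LinearMap.finrank_range_add_finrank_ker (Fintype.linearCombination ℝ Q.normal)
    have hs : LinearMap.range (Fintype.linearCombination ℝ Q.normal) = ⊤ := by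
      obtain ⟨p, hp⟩ := Q.interior_nonempty
      obtain ⟨f, -, -, hli⟩ := Q.exists_vertex (interior_subset hp)
      rw [Fintype.range_linearCombination, eq_top_iff,
        ← hli.span_eq_top_of_card_eq_finrank' (by simp)]
      exact Submodule.span_mono (Set.range_comp_subset_range f Q.normal)
    rw [hs, finrank_top] at h
    simp only [Module.finrank_fin_fun, finrank_euclideanSpace_fin] at h
    exact Nat.eq_sub_of_add_eq' h
  rw [Module.finrank_prod, h1, h2]
  omega

/-- The omniorientation induced by `(P, Λ)` is special when `c₁(c_τ) = 0` in `H²(M; ℤ)`. -/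
def IsSpecial : Prop := Q.cTau.firstChernClass = 0

end QuasitoricPair

end Stable

end

/-!
The first Chern class of `ρ₁ ⊕ … ⊕ ρ_m = Z_P ×_K ℂᵐ` is that of its determinant, the line bundle
`Z_P ×_K ℂ` associated with the character `t ↦ ∏ⱼ tⱼ` of `K`.

If every column of `Λ` sums to `1`, this character is the product of the `n` characters
`t ↦ ∏ⱼ tⱼ ^ λᵢⱼ`, each of which is trivial on `K = ker Λ`. So all determinant transition functions
are `1` and `c₁ = 0` (`firstChernClass_eq_zero`).

Conversely, suppose that `c₁ = 0`. A partition of unity makes the sheaf of continuous complex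
functions acyclic (`exists_primitive_of_cocycle`), so the exponential sequence shows that the
determinant bundle is trivial (`exists_section_of_firstChernClass_eq_zero`). A trivialization is a
continuous `φ : Z_P → ℂ*` with `φ (t z) = (∏ⱼ tⱼ) φ z` for `t ∈ K`
(`exists_equivariant_of_isSpecial`). Choose a path `γ` in `P` that meets every facet, and lift
`(θ, r) ↦ φ (exp (iθ) · γ r)` to a continuous logarithm `h` on `ℝᵐ × ℝ`. The number
`h (θ + 2π eⱼ, r) - h (θ, r)` does not depend on `(θ, r)`, and vanishes where `γ r` lies on the
`j`-th facet, because there the `j`-th circle of `Tᵐ` acts trivially. So `h` is `2πℤᵐ`-periodic in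
`θ` (this replaces the simple connectedness of `Z_P`). For an integral vector `a` with `Λ a = 0`, on
the other hand, equivariance along the circle `s ↦ exp (isa)` of `K` gives
`h (2πa, r) - h (0, r) = 2πi ∑ⱼ aⱼ`. Hence `∑ⱼ aⱼ = 0`, and applying this to
`a = eⱼ - ∑ᵢ λᵢⱼ eᵢ` gives the column sums.
-/

noncomputable section

/-! ### Continuous logarithms -/

/-- A continuous nowhere vanishing function on a simply connected, locally path connected space has
a continuous logarithm. -/
theorem exists_continuous_log {X : Type*} [TopologicalSpace X] [SimplyConnectedSpace X]
    [LocallyPathConnectedSpace X] {g : X → ℂ} (hg : Continuous g) (h0 : ∀ x, g x ≠ 0) :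
    ∃ h : X → ℂ, Continuous h ∧ ∀ x, Complex.exp (h x) = g x := by
  obtain ⟨x₀⟩ : Nonempty X := inferInstance
  obtain ⟨F, ⟨-, hF⟩, -⟩ := Complex.isCoveringMapOn_exp.existsUnique_continuousMap_lifts
    ⟨g, hg⟩ (Complex.exp_log (h0 x₀)) h0
  exact ⟨F, F.continuous, fun x => congrFun hF x⟩

/-- A continuous function with values in `2πiℤ` is constant on a connected space. -/
theorem eq_of_exp_eq_one {X : Type*} [TopologicalSpace X] [PreconnectedSpace X] {u : X → ℂ}
    (hu : Continuous u) (h : ∀ x, Complex.exp (u x) = 1) (x y : X) : u x = u y := by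
  set v : X → ℂ := fun x => u x / (2 * Real.pi * Complex.I) with hv
  have hvu : ∀ x, 2 * Real.pi * Complex.I * v x = u x := fun x =>
    mul_div_cancel₀ _ Complex.two_pi_I_ne_zero
  have hr : ∀ x, ((round (v x).re : ℤ) : ℂ) = v x := fun x =>
    exp_eq_one_iff_int (by rw [hvu, h])
  have hc : Continuous fun x => round (v x).re := by
    rw [← continuousOn_univ]
    exact continuousOn_int_of_complex (hu.div_const _).continuousOn fun x _ => hr x
  rw [← hvu x, ← hvu y, ← hr x, ← hr y, PreconnectedSpace.constant ‹_› hc]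

/-! ### Vanishing of the first Chern class -/

section Vanishing

theorem LocallyFinite.continuousAt_finsum {X ι M : Type*} [TopologicalSpace X]
    [AddCommMonoid M] [TopologicalSpace M] [ContinuousAdd M] {f : ι → X → M} {x : X}
    (hf : LocallyFinite fun i => Function.support (f i)) (hc : ∀ i, ContinuousAt (f i) x) :
    ContinuousAt (fun y => ∑ᶠ i, f i y) x := by
  obtain ⟨I, hI⟩ := hf.exists_finset_support x
  refine ContinuousAt.congr (f := fun y => ∑ i ∈ I, f i y) (tendsto_finsetSum I fun i _ => hc i) ?_
  filter_upwards [hI] with y hy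
  exact (finsum_eq_sum_of_support_subset _ hy).symm

variable {B : Type*} [TopologicalSpace B] [T2Space B] [ParacompactSpace B]

/-- On a paracompact Hausdorff space a Čech 1-cocycle of continuous complex functions on a cover is
the coboundary of continuous functions on the same cover. -/
theorem exists_primitive_of_cocycle {W : B → Set B} (hW : IsPointedCover W)
    {c : (Fin 2 → B) → B → ℂ} (hc : ∀ x, ContinuousOn (c x) {b | ∀ i, b ∈ W (x i)})
    (hd : ∀ x b, (∀ i, b ∈ W (x i)) → cechD B ℂ 1 c x b = 0) :
    ∃ f : B → B → ℂ, (∀ x, ContinuousOn (f x) (W x)) ∧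
      ∀ x y b, b ∈ W x → b ∈ W y → c ![x, y] b = f x b - f y b := by
  obtain ⟨ρ, hρ⟩ := PartitionOfUnity.exists_isSubordinate isClosed_univ W (fun x => (hW x).1)
    fun x _ => Set.mem_iUnion.2 ⟨x, (hW x).2⟩
  refine ⟨fun x b => ∑ᶠ w, ρ w b • c ![x, w] b, fun x b hb => ?_, fun x y b hx hy => ?_⟩
  · refine ContinuousAt.continuousWithinAt (LocallyFinite.continuousAt_finsum
      (ρ.locallyFinite.subset fun w => Function.support_smul_subset_left (ρ w) (c ![x, w]))
      fun w => ?_)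
    by_cases hw : b ∈ tsupport (ρ w)
    · have ho : {b | ∀ i, b ∈ W (![x, w] i)} ∈ nhds b :=
        Filter.mem_of_superset (((hW x).1.inter (hW w).1).mem_nhds ⟨hb, hρ w hw⟩)
          fun b' hb' i => by fin_cases i; exacts [hb'.1, hb'.2]
      exact (ρ w).continuous.continuousAt.smul ((hc ![x, w]).continuousAt ho)
    · refine ContinuousAt.congr (f := fun _ => (0 : ℂ)) continuousAt_const ?_
      filter_upwards [(isClosed_tsupport _).isOpen_compl.mem_nhds hw] with b' hb'
      rw [image_eq_zero_of_notMem_tsupport hb', zero_smul]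
  · simp only [← ρ.sum_finsupport_smul_eq_finsum (x₀ := b) (fun w b => c ![x, w] b),
      ← ρ.sum_finsupport_smul_eq_finsum (x₀ := b) (fun w b => c ![y, w] b)]
    rw [← Finset.sum_sub_distrib]
    have h1 : ∀ w ∈ ρ.finsupport b, ρ w b • c ![x, w] b - ρ w b • c ![y, w] b =
        ρ w b • c ![x, y] b := by
      intro w hw
      have hbw : b ∈ W w := hρ w (subset_tsupport _ ((ρ.mem_finsupport b).1 hw))
      have h2 := hd ![x, y, w] b fun i => by fin_cases i; exacts [hx, hy, hbw]
      rw [cechD_one_apply] at h2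
      simp only [Matrix.cons_val] at h2
      rw [← smul_sub]
      congr 1
      linear_combination -h2
    rw [Finset.sum_congr rfl h1, ← Finset.sum_smul, ρ.sum_finsupport (Set.mem_univ b), one_smul]

open Bundle

variable (F : Type*) [NormedAddCommGroup F] [NormedSpace ℂ F] [FiniteDimensional ℂ F]
  (E : B → Type*) [TopologicalSpace (TotalSpace F E)]
  [∀ b, AddCommGroup (E b)] [∀ b, Module ℂ (E b)]
  [∀ b, TopologicalSpace (E b)] [FiberBundle F E] [VectorBundle ℂ F E]

theorem isFirstChernClass_firstChernClass : IsFirstChernClass F E (firstChernClass F E) :=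
  (existsUnique_isFirstChernClass (F := F) (E := E)).choose_spec.1

theorem IsFirstChernClass.eq_firstChernClass {c : CechH B ℤ 2} (h : IsFirstChernClass F E c) :
    firstChernClass F E = c :=
  ((existsUnique_isFirstChernClass (F := F) (E := E)).choose_spec.2 c h).symm

/-- A complex vector bundle whose transition functions have determinant `1` has `c₁ = 0`. -/
theorem firstChernClass_eq_zero (h : ∀ x y b, b ∈ (trivializationAt F E x).baseSet →
    b ∈ (trivializationAt F E y).baseSet → detTransition F E x y b = 1) :
    firstChernClass F E = 0 := by
  refine IsFirstChernClass.eq_firstChernClass F E ⟨fun x => (trivializationAt F E x).baseSet,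
    fun x => ⟨(trivializationAt F E x).open_baseSet, mem_baseSet_trivializationAt F E x⟩,
    fun x => subset_rfl, 0, fun x => continuousOn_const, fun x b hb => ?_, 0, rfl,
    fun x b _ => ?_⟩
  · rw [h _ _ _ (hb 0) (hb 1)]
    simp
  · rw [map_zero]
    simp

/-- If `c₁(E) = 0`, then the determinant line bundle of `E` has a continuous nowhere vanishing
section, given here by its local representatives `σₓ`. -/
theorem exists_section_of_firstChernClass_eq_zero (h : firstChernClass F E = 0) :
    ∃ W : B → Set B, IsPointedCover W ∧ (∀ x, W x ⊆ (trivializationAt F E x).baseSet) ∧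
      ∃ σ : B → B → ℂ, (∀ x, ContinuousOn (σ x) (W x)) ∧ (∀ x b, σ x b ≠ 0) ∧
        ∀ x y b, b ∈ W x → b ∈ W y → σ x b = detTransition F E x y b * σ y b := by
  obtain ⟨U, hU, hUb, ℓ, hℓ, he, z, hzc, hz⟩ := isFirstChernClass_firstChernClass F E
  rw [h, QuotientAddGroup.eq_zero_iff, AddSubgroup.mem_addSubgroupOf] at hzc
  obtain ⟨_, ⟨n, ⟨V, hV, hn⟩, rfl⟩, e, ⟨V', hV', he0⟩, hze⟩ := AddSubgroup.mem_sup.1 hzc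
  have hW := (hU.inter hV).inter hV'
  set W : B → Set B := fun x => U x ∩ V x ∩ V' x
  -- Subtracting the integral cochain `n` turns the logarithms `ℓ` into a cocycle.
  set c : (Fin 2 → B) → B → ℂ := fun x b => ℓ x b - (n x b : ℂ) with hcdef
  have hc : ∀ x, ContinuousOn (c x) {b | ∀ i, b ∈ W (x i)} := fun x =>
    ((hℓ x).mono fun b hb i => (hb i).1.1).sub
      (continuous_of_discreteTopology (f := fun k : ℤ => (k : ℂ)) |>.comp_continuousOn
        ((hn x).mono fun b hb i => (hb i).1.2))
  have hd : ∀ x b, (∀ i, b ∈ W (x i)) → cechD B ℂ 1 c x b = 0 := by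
    intro x b hb
    have h1 := hz x b fun i => (hb i).1.1
    have h2 := he0 x b fun i => (hb i).2
    have h3 : z.1 x b = cechD B ℤ 1 n x b := by
      rw [← hze, Pi.add_apply, Pi.add_apply, h2, add_zero]
    rw [h3, cechD_one_apply, cechD_one_apply] at h1
    rw [cechD_one_apply]
    push_cast at h1
    simp only [hcdef]
    linear_combination -h1
  obtain ⟨f, hf, hcf⟩ := exists_primitive_of_cocycle hW hc hd
  refine ⟨W, hW, fun x b hb => hUb x hb.1.1,
    fun x b => Complex.exp (2 * Real.pi * Complex.I * f x b),
    fun x => (continuousOn_const.mul (hf x)).cexp, fun x b => Complex.exp_ne_zero _,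
    fun x y b hx hy => ?_⟩
  have h1 := he ![x, y] b fun i => by fin_cases i; exacts [hx.1.1, hy.1.1]
  have h2 := hcf x y b hx hy
  simp only [hcdef] at h2
  have h3 : f x b = ℓ ![x, y] b + f y b - (n ![x, y] b : ℂ) := by linear_combination -h2
  simp only [Matrix.cons_val_zero, Matrix.cons_val_one] at h1
  beta_reduce
  rw [← h1, h3, mul_sub, mul_add, Complex.exp_sub, Complex.exp_add,
    mul_comm (2 * Real.pi * Complex.I) (n ![x, y] b : ℂ), Complex.exp_int_mul_two_pi_mul_I, div_one]

end Vanishing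

/-! ### The determinant of `Z_P ×_K ℂᵐ` -/

theorem zpow_finsetSum {G ι : Type*} [CommGroup G] (g : G) (s : Finset ι) (f : ι → ℤ) :
    g ^ ∑ i ∈ s, f i = ∏ i ∈ s, g ^ f i := by
  classical
  induction s using Finset.induction_on with
  | empty => simp
  | insert i s hi ih => rw [Finset.sum_insert hi, Finset.prod_insert hi, zpow_add, ih]

namespace QuasitoricPair

variable {n m : ℕ} (Q : QuasitoricPair n m)

/-- The slice whose trivialization is the preferred one around `x`. -/
def sliceAt (x : Q.M) : Q.Slice := (Slice.exists_mem_base x).choose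

/-- The determinant transition functions are the character `t ↦ ∏ⱼ tⱼ` applied to the `K`-valued
transition functions of `Z_P → M`. -/
theorem detTransition_proj {x y : Q.M} {z : Q.Z} (hx : Q.proj z ∈ (Q.sliceAt x).base)
    (hy : Q.proj z ∈ (Q.sliceAt y).base) :
    detTransition (Fin m → ℂ) Q.Rho x y (Q.proj z) =
      ∏ j, ((((Q.sliceAt x).k z * ((Q.sliceAt y).k z)⁻¹ : Q.K) : Fin m → Circle) j : ℂ) := by
  rw [← Matrix.det_diagonal, ← LinearMap.det_toLin']
  change LinearMap.det (((Q.sliceAt y).triv.coordChangeL ℂ (Q.sliceAt x).triv (Q.proj z) :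
    (Fin m → ℂ) →L[ℂ] (Fin m → ℂ)) : (Fin m → ℂ) →ₗ[ℂ] (Fin m → ℂ)) = _
  congr 1
  refine LinearMap.ext fun v => (Slice.coordChange_apply _ _ hy hx v).trans ?_
  funext j
  rw [Matrix.toLin'_apply, Matrix.mulVec_diagonal]
  rfl

theorem prod_zpow_eq_one {t : Fin m → Circle} (ht : t ∈ Q.K) (i : Fin n) :
    ∏ j, t j ^ Q.Λ i j = 1 :=
  congrFun (MonoidHom.mem_ker.1 ht) i

theorem isSpecial_of_column_sums (h : ∀ j, ∑ i, Q.Λ i j = 1) : Q.IsSpecial := by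
  refine firstChernClass_eq_zero _ _ fun x y b hx hy => ?_
  obtain ⟨z, rfl⟩ := Q.isOpenQuotientMap_proj.surjective b
  rw [Q.detTransition_proj hx hy]
  set t : Q.K := (Q.sliceAt x).k z * ((Q.sliceAt y).k z)⁻¹
  have h1 : ∏ j, t.1 j = 1 := by
    calc ∏ j, t.1 j = ∏ j, ∏ i, t.1 j ^ Q.Λ i j := by
          refine Finset.prod_congr rfl fun j _ => ?_
          rw [← zpow_finsetSum, h, zpow_one]
      _ = 1 := by
          rw [Finset.prod_comm]
          exact Finset.prod_eq_one fun i _ => Q.prod_zpow_eq_one t.2 i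
  have h2 := congrArg Circle.coeHom h1
  rwa [map_prod, map_one] at h2

/-- A trivialization of the determinant of `Z_P ×_K ℂᵐ`, as an equivariant function on `Z_P`. -/
theorem exists_equivariant_of_isSpecial (h : Q.IsSpecial) :
    ∃ φ : Q.Z → ℂ, Continuous φ ∧ (∀ z, φ z ≠ 0) ∧
      ∀ (t : Q.K) (z : Q.Z), φ (t • z) = (∏ j, (t.1 j : ℂ)) * φ z := by
  obtain ⟨W, hW, hWb, σ, hσ, hσ0, hσt⟩ :=
    exists_section_of_firstChernClass_eq_zero (Fin m → ℂ) Q.Rho h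
  set ψ : Q.M → Q.Z → ℂ := fun x z => σ x (Q.proj z) *
    ∏ j, (((Q.sliceAt x).k z : Fin m → Circle) j : ℂ)⁻¹ with hψ
  have hψe : ∀ x y z, Q.proj z ∈ W x → Q.proj z ∈ W y → ψ x z = ψ y z := by
    intro x y z hx hy
    simp only [hψ]
    rw [hσt x y _ hx hy, Q.detTransition_proj (hWb x hx) (hWb y hy), mul_right_comm,
      ← Finset.prod_mul_distrib, mul_comm]
    congr 1
    refine Finset.prod_congr rfl fun j _ => ?_
    rw [Subgroup.coe_mul, Subgroup.coe_inv, Pi.mul_apply, Pi.inv_apply, Circle.coe_mul,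
      Circle.coe_inv, mul_right_comm, mul_inv_cancel₀ (Circle.coe_ne_zero _), one_mul]
  refine ⟨fun z => ψ (Q.proj z) z, ?_, fun z => ?_, fun t z => ?_⟩
  · rw [continuous_iff_continuousAt]
    intro z
    have hz : z ∈ (Q.sliceAt (Q.proj z)).V :=
      (Q.sliceAt _).mem_V_of_proj (hWb _ (hW (Q.proj z)).2)
    have hc : ContinuousAt (ψ (Q.proj z)) z := by
      refine ContinuousAt.mul ?_ ?_
      · exact ((hσ _).continuousAt ((hW _).1.mem_nhds (hW (Q.proj z)).2)).comp
          Q.isOpenQuotientMap_proj.continuous.continuousAt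
      · refine tendsto_finsetProd _ fun j _ => ContinuousAt.inv₀ ?_ (Circle.coe_ne_zero _)
        exact continuous_subtype_val.continuousAt.comp
          ((continuous_apply j).continuousAt.comp
            ((Q.sliceAt (Q.proj z)).continuousAt_k continuousAt_id hz))
    refine hc.congr ?_
    filter_upwards [((hW (Q.proj z)).1.preimage Q.isOpenQuotientMap_proj.continuous).mem_nhds
      (hW (Q.proj z)).2] with z' hz'
    exact hψe _ _ z' hz' (hW _).2
  · exact mul_ne_zero (hσ0 _ _)
      (Finset.prod_ne_zero_iff.2 fun j _ => inv_ne_zero (Circle.coe_ne_zero _))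
  · have hz : z ∈ (Q.sliceAt (Q.proj z)).V :=
      (Q.sliceAt _).mem_V_of_proj (hWb _ (hW (Q.proj z)).2)
    simp only [hψ, Q.proj_smul]
    rw [mul_left_comm, ← Finset.prod_mul_distrib, (Q.sliceAt _).map_smul z hz]
    congr 1
    refine Finset.prod_congr rfl fun j _ => ?_
    rw [Subgroup.coe_mul, Subgroup.coe_inv, Pi.mul_apply, Pi.inv_apply, Circle.coe_mul,
      Circle.coe_inv, mul_inv, inv_inv, mul_comm]

/-! ### Paths in the polytope and loops in the torus orbits -/

theorem convex_carrier : Convex ℝ Q.carrier := by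
  intro x hx y hy a b ha hb hab j
  rw [Q.dist_combo j x y a b hab]
  exact add_nonneg (mul_nonneg ha (hx j)) (mul_nonneg hb (hy j))

theorem facet_nonempty (j : Fin m) : (Q.facet j).Nonempty := by
  obtain ⟨p, hp⟩ := Q.interior_nonempty
  have hp' : p ∈ Q.carrier := interior_subset hp
  obtain ⟨x, hx, hxj⟩ := Q.irredundant j
  have hd : 0 < Q.dist j p - Q.dist j x := by linarith [hp' j]
  -- The point where the segment from `p` to `x` crosses the `j`-th hyperplane.
  set a := -Q.dist j x / (Q.dist j p - Q.dist j x) with ha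
  set b := Q.dist j p / (Q.dist j p - Q.dist j x) with hb
  have ha0 : 0 ≤ a := div_nonneg (by linarith) hd.le
  have hb0 : 0 ≤ b := div_nonneg (hp' j) hd.le
  have hab : a + b = 1 := by
    rw [ha, hb, ← add_div, neg_add_eq_sub, div_self hd.ne']
  have h0 : Q.dist j (a • p + b • x) = 0 := by
    rw [Q.dist_combo j p x a b hab, ha, hb]
    ring
  refine ⟨a • p + b • x, fun i => ?_, h0⟩
  rcases eq_or_ne i j with rfl | hij
  · exact h0.ge
  · rw [Q.dist_combo i p x a b hab]
    exact add_nonneg (mul_nonneg ha0 (hp' i)) (mul_nonneg hb0 (hx i hij))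

/-- There is a path in `P` which meets every facet. -/
theorem exists_path_through_facets : ∃ γ : ℝ → EuclideanSpace ℝ (Fin n), Continuous γ ∧
    (∀ r, γ r ∈ Q.carrier) ∧ ∀ j, ∃ r, γ r ∈ Q.facet j := by
  obtain ⟨p, hp⟩ := Q.interior_nonempty
  have hP : IsPathConnected Q.carrier := Q.convex_carrier.isPathConnected ⟨p, interior_subset hp⟩
  choose q hq using Q.facet_nonempty
  obtain ⟨γ, t, hγ, hγt⟩ := hP.exists_path_through_family' (Fin.cons p q)
    (Fin.cases (interior_subset hp) fun j => (hq j).1)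
  refine ⟨γ.extend, γ.continuous_extend, fun r => hγ _, fun j => ⟨t j.succ, ?_⟩⟩
  rw [γ.extend_apply (t j.succ).2, Subtype.coe_eta, hγt, Fin.cons_succ]
  exact hq j

/-- The section `p ↦ (p, (√(⟨aⱼ, p⟩ + bⱼ))ⱼ)` of `Z_P → P`. -/
def positiveSection (p : Q.carrier) : Q.Z :=
  ⟨(p.1, fun j => (√(Q.dist j p.1) : ℂ)), p.2, fun j => by
    rw [Complex.norm_real, Real.norm_eq_abs, sq_abs, Real.sq_sqrt (p.2 j)]⟩

theorem continuous_positiveSection : Continuous Q.positiveSection := by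
  refine Continuous.subtype_mk (continuous_subtype_val.prodMk (continuous_pi fun j => ?_)) _
  exact Complex.continuous_ofReal.comp
    (Real.continuous_sqrt.comp ((Q.continuous_dist j).comp continuous_subtype_val))

/-- Over the `j`-th facet the `j`-th coordinate circle of `Tᵐ` acts trivially. -/
theorem smul_positiveSection_eq {p : Q.carrier} {j : Fin m} (hp : p.1 ∈ Q.facet j)
    {s t : Fin m → Circle} (h : ∀ i, i ≠ j → s i = t i) :
    s • Q.positiveSection p = t • Q.positiveSection p := by
  refine Subtype.ext (Prod.ext rfl (funext fun i => ?_))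
  change (s i : ℂ) * (√(Q.dist i p.1) : ℂ) = (t i : ℂ) * (√(Q.dist i p.1) : ℂ)
  rcases eq_or_ne i j with rfl | hij
  · rw [hp.2]
    simp
  · rw [h i hij]

/-- An integral vector in the kernel of `Λ` spans a one-parameter subgroup of `K`. -/
theorem exp_mem_K {a : Fin m → ℤ} (ha : Q.Λ.mulVec a = 0) (s : ℝ) :
    (fun j => Circle.exp (s * a j)) ∈ Q.K := by
  refine MonoidHom.mem_ker.2 (funext fun i => ?_)
  have h1 : ∀ j, Circle.exp (s * a j) ^ Q.Λ i j = Circle.exp s ^ (Q.Λ i j * a j) := by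
    intro j
    rw [← Circle.exp_zsmul, ← Circle.exp_zsmul]
    congr 1
    simp only [zsmul_eq_mul]
    push_cast
    ring
  rw [torusHom_apply]
  simp only [h1]
  rw [← zpow_finsetSum]
  have h2 : ∑ j, Q.Λ i j * a j = 0 := congrFun ha i
  rw [h2, zpow_zero]
  rfl

/-- If the determinant of `Z_P ×_K ℂᵐ` is trivial, then the character `t ↦ ∏ⱼ tⱼ` has degree zero on
every circle in `K`. -/
theorem sum_eq_zero_of_equivariant {φ : Q.Z → ℂ} (hφ : Continuous φ) (h0 : ∀ z, φ z ≠ 0)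
    (hK : ∀ (t : Q.K) (z : Q.Z), φ (t • z) = (∏ j, (t.1 j : ℂ)) * φ z)
    {a : Fin m → ℤ} (ha : Q.Λ.mulVec a = 0) : ∑ j, a j = 0 := by
  obtain ⟨γ, hγ, hγP, hγF⟩ := Q.exists_path_through_facets
  set τ : (Fin m → ℝ) → (Fin m → Circle) := fun θ j => Circle.exp (θ j) with hτ
  have hτc : Continuous τ := continuous_pi fun j => Circle.exp.continuous.comp (continuous_apply j)
  set w : ℝ → Q.Z := fun r => Q.positiveSection ⟨γ r, hγP r⟩ with hw
  have hwc : Continuous w := Q.continuous_positiveSection.comp (hγ.subtype_mk hγP)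
  obtain ⟨h, hc, he⟩ := exists_continuous_log
    (g := fun x : (Fin m → ℝ) × ℝ => φ (τ x.1 • w x.2))
    (hφ.comp ((hτc.comp continuous_fst).smul (hwc.comp continuous_snd))) fun x => h0 _
  have hτp : ∀ θ j, τ (θ + Pi.single j (2 * Real.pi)) = τ θ := by
    intro θ j
    funext i
    simp only [hτ, Pi.add_apply]
    rcases eq_or_ne i j with rfl | hij
    · rw [Pi.single_eq_same, Circle.exp_add_two_pi]
    · rw [Pi.single_eq_of_ne hij, add_zero]
  have hper : ∀ j θ r, h (θ + Pi.single j (2 * Real.pi), r) = h (θ, r) := by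
    intro j θ r
    obtain ⟨r', hr'⟩ := hγF j
    have h1 := eq_of_exp_eq_one
      (u := fun x : (Fin m → ℝ) × ℝ => h (x.1 + Pi.single j (2 * Real.pi), x.2) - h x)
      (by fun_prop) (fun x => by
        rw [Complex.exp_sub, he, he, hτp]
        exact div_self (h0 _)) (θ, r) (θ, r')
    -- On the facet, rotation by an arbitrary angle `s` changes `h` by a constant.
    have h2 := eq_of_exp_eq_one
      (u := fun s : ℝ => h (θ + Pi.single j s, r') - h (θ, r'))
      (by
        have : Continuous fun s : ℝ => (Pi.single j s : Fin m → ℝ) := continuous_single (A := fun _ => ℝ) j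
        fun_prop) (fun s => by
        rw [Complex.exp_sub, he, he]
        have : τ (θ + Pi.single j s) • w r' = τ θ • w r' :=
          Q.smul_positiveSection_eq hr' fun i hij => by
            simp only [hτ, Pi.add_apply]
            rw [Pi.single_eq_of_ne hij, add_zero]
        rw [this]
        exact div_self (h0 _)) (2 * Real.pi) 0
    simp only [Pi.single_zero, add_zero, sub_self] at h1 h2
    rw [h2] at h1
    exact sub_eq_zero.1 h1
  have hperZ : ∀ (j : Fin m) (k : ℤ) (θ : Fin m → ℝ),
      h (θ + Pi.single j (2 * Real.pi * k), 0) = h (θ, 0) := by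
    intro j k
    induction k using Int.induction_on with
    | zero => intro θ; simp
    | succ k ih =>
      intro θ
      have : θ + Pi.single j (2 * Real.pi * ((k + 1 : ℤ) : ℝ)) =
          (θ + Pi.single j (2 * Real.pi * ((k : ℤ) : ℝ))) + Pi.single j (2 * Real.pi) := by
        rw [add_assoc, ← Pi.single_add]
        congr 2
        push_cast
        ring
      rw [this, hper, ih]
    | pred k ih =>
      intro θ
      have : θ + Pi.single j (2 * Real.pi * ((-k : ℤ) : ℝ)) =
          (θ + Pi.single j (2 * Real.pi * ((-k - 1 : ℤ) : ℝ))) + Pi.single j (2 * Real.pi) := by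
        rw [add_assoc, ← Pi.single_add]
        congr 2
        push_cast
        ring
      rw [← hper, ← this, ih]
  have hlat : ∀ S : Finset (Fin m),
      h (∑ j ∈ S, Pi.single j (2 * Real.pi * (a j : ℝ)), 0) = h (0, 0) := by
    classical
    intro S
    induction S using Finset.induction_on with
    | empty => rw [Finset.sum_empty]
    | insert j S hj ih => rw [Finset.sum_insert hj, add_comm, hperZ, ih]
  -- Equivariance determines `h` along the circle `s ↦ exp (isa)` of `K`.
  have hloop := eq_of_exp_eq_one
    (u := fun s : ℝ => h (fun j => s * a j, 0) - h (0, 0) - s * Complex.I * ∑ j, (a j : ℂ))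
    (by fun_prop) (fun s => by
      have h1 : τ (fun j => s * a j) • w 0 =
          (⟨fun j => Circle.exp (s * a j), Q.exp_mem_K ha s⟩ : Q.K) • (τ 0 • w 0) := by
        have : τ 0 = 1 := funext fun j => Circle.exp_zero
        rw [this, one_smul]
        rfl
      have h2 : ∏ j, (Circle.exp (s * a j) : ℂ) =
          Complex.exp (s * Complex.I * ∑ j, (a j : ℂ)) := by
        rw [Finset.mul_sum, Complex.exp_sum]
        refine Finset.prod_congr rfl fun j _ => ?_
        rw [Circle.coe_exp]
        congr 1
        push_cast
        ring
      rw [Complex.exp_sub, Complex.exp_sub, he, he, h1, hK, ← h2,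
        mul_div_assoc, div_self (h0 _), mul_one]
      exact div_self (Finset.prod_ne_zero_iff.2 fun j _ => Circle.coe_ne_zero _))
    (2 * Real.pi) 0
  have h1 : (fun j => 2 * Real.pi * (a j : ℝ)) =
      ∑ j, Pi.single j (2 * Real.pi * (a j : ℝ)) := (Finset.univ_sum_single _).symm
  have h2 : (fun j => (0 : ℝ) * (a j : ℝ)) = 0 := funext fun j => zero_mul _
  have h3 : (2 * Real.pi * Complex.I : ℂ) * ∑ j, (a j : ℂ) = 0 := by
    beta_reduce at hloop
    rw [h1, h2, hlat] at hloop
    push_cast at hloop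
    linear_combination -hloop
  have h4 := (mul_eq_zero.1 h3).resolve_left Complex.two_pi_I_ne_zero
  exact_mod_cast h4

theorem column_sums_of_isSpecial (h : Q.IsSpecial) (j : Fin m) : ∑ i, Q.Λ i j = 1 := by
  obtain ⟨φ, hφ, h0, hK⟩ := Q.exists_equivariant_of_isSpecial h
  have hsub : ∀ i i', Q.Λ i (Fin.castLE Q.le i') = (1 : Matrix (Fin n) (Fin n) ℤ) i i' :=
    fun i i' => congrFun (congrFun Q.refined i) i'
  -- The first `n` columns are standard, so `eⱼ - ∑ᵢ λᵢⱼ eᵢ` is in the kernel of `Λ`.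
  have ha : Q.Λ.mulVec (Pi.single j 1 - ∑ i, Pi.single (Fin.castLE Q.le i) (Q.Λ i j)) = 0 := by
    funext i
    rw [Matrix.mulVec_sub, Matrix.mulVec_sum]
    simp [hsub, Matrix.one_apply]
  have h1 := Q.sum_eq_zero_of_equivariant hφ h0 hK ha
  simp only [Pi.sub_apply, Finset.sum_apply, Finset.sum_sub_distrib] at h1
  rw [Finset.sum_comm] at h1
  simp only [Finset.sum_pi_single', Finset.mem_univ, if_true] at h1
  linarith

end QuasitoricPair

end

theorem mainTheorem12 {n m : ℕ} (Q : QuasitoricPair n m) :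
    Q.IsSpecial ↔ ∀ j : Fin m, ∑ i : Fin n, Q.Λ i j = 1 :=
  ⟨Q.column_sums_of_isSpecial, Q.isSpecial_of_column_sums⟩
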